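/- Let $\mathcal A$ be a unital complex $*$-algebra and let $(\mathcal A,\mathcal H,D)$ be a spectral triple with $\mathcal H\neq 0$: $\mathcal A$ is represented on the Hilbert space $\mathcal H$ by a unital $*$-representation, and $D$ is a self-adjoint operator with compact resolvent such that every $a\in\mathcal A$ preserves $\mathrm{dom}(D)$ and $[D,a]$ extends to a bounded operator. Let $F$ be the sign of $D$ (with $\mathrm{sign}(0)=1$). **Quantum double suspension.** On $\ell^2(\mathbb N)$ with standard basis $(e_n)_{n\ge 0}$ let $l$ be the left shift, $le_n=e_{n-1}$, $le_0=0$, and let $Ne_n=ne_n$. Let $\mathcal S\subset\mathcal B(\ell^2(\mathbb N))$ be the space of finitely supported matrices, and for a Laurent polynomial $f=\sum_n\lambda_nz^n$ put $\sigma'(f)=\sum_{n\ge0}\lambda_nl^n+\sum_{n>0}\lambda_{-n}l^{*n}$. Let $\Sigma^2\mathcal A$ be the subalgebra of $\mathcal A\otimes\mathcal B(\ell^2(\mathbb N))$ generated by all $a\otimes T$ ($a\in\mathcal A$, $T\in\mathcal S$) and all $1\otimes\sigma'(f)$ ($f\in\mathbb C[z,z^{-1}]$), acting on $\mathcal H\otimes\ell^2(\mathbb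 N)$, and let $\Sigma^2D=D\otimes 1+F\otimes N$. The algebra $\mathcal A\otimes\mathcal S$ is a nonunital subalgebra of $\Sigma^2\mathcal A$. **Calculus.** For a unital algebra $\mathcal B$ represented on a Hilbert space $\mathcal K$ with an operator $D$ having bounded commutators with $\mathcal B$, let $\Omega^n(\mathcal B)=\mathcal B\otimes(\mathcal B/\mathbb C)^{\otimes n}$ be the reduced universal forms, with $d(b_0\otimes\overline{b_1}\otimes\cdots\otimes\overline{b_n})=1\otimes\overline{b_0}\otimes\overline{b_1}\otimes\cdots\otimes\overline{b_n}$. Let $\pi$ map $b_0\otimes\overline{b_1}\otimes\cdots\otimes\overline{b_n}$ to the class of $b_0[D,b_1]\cdots[D,b_n]$ in the quotient of the bounded operators on $\mathcal K$ by the compact operators, let $J_0^n=\ker(\pi|_{\Omega^n(\mathcal B)})$, $J^n(\mathcal B)=J_0^n+dJ_0^{n-1}$ (with $J_0^{-1}=0$), and $\Omega^n_D(\mathcal B)=\Omega^n(\mathcal B)/J^n(\mathcal B)$. For a nonunital algebra $\mathcal C$ with minimal unitization $\widetilde{\mathcal C}$, represented by $(c,\lambda)\mapsto c+\lambda 1$,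 let $\Omega^n(\mathcal C)\subseteq\Omega^n(\widetilde{\mathcal C})$ be the span of the forms $c_0\,dc_1\cdots dc_n$ with all $c_i\in\mathcal C$, and $\Omega^n_D(\mathcal C)=\Omega^n(\mathcal C)/(\Omega^n(\mathcal C)\cap J^n(\widetilde{\mathcal C}))$. **Proposition.** There are isomorphisms of complex vector spaces 1. $\Omega^1_{\Sigma^2D}(\Sigma^2\mathcal A)\cong\Omega^1_{\Sigma^2D}(\mathcal A\otimes\mathcal S)\oplus\mathbb C[z,z^{-1}]$, 2. $\Omega^n_{\Sigma^2D}(\Sigma^2\mathcal A)\cong\Omega^n_{\Sigma^2D}(\mathcal A\otimes\mathcal S)$ for all $n\ge2$. They are the canonical ones: in both cases the class of $s_0\,ds_1\cdots ds_n$ with all $s_i\in\mathcal A\otimes\mathcal S$ corresponds to the class of $s_0\,ds_1\cdots ds_n$ in $\Omega^n_{\Sigma^2D}(\mathcal A\otimes\mathcal S)$, and in (1) each $f\in\mathbb C[z,z^{-1}]$ corresponds to the class of a form $\omega\in\Omega^1(\Sigma^2\mathcal A)$ such that $\pi(\omega)$ is the class of $F\otimes\sigma'(f)$. -/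

import Mathlib

open scoped TensorProduct LaurentPolynomial InnerProductSpace

noncomputable section

namespace QDS

/-! ### Commutators with unbounded operators -/

section Commutator

variable {H : Type*} [NormedAddCommGroup H] [InnerProductSpace ℂ H]

/-- The bounded operator `T` preserves the domain of `D`, and `[D, T]` extends from the domain
of `D` to the bounded operator `C`. -/
def IsCommutator (D : H →ₗ.[ℂ] H) (T C : H →L[ℂ] H) : Prop :=
  ∀ x : D.domain, ∃ h : T x ∈ D.domain, C x = D ⟨T x, h⟩ - T (D x)

theorem IsCommutator.unique {D : H →ₗ.[ℂ] H} (hD : Dense (D.domain : Set H))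
    {T C C' : H →L[ℂ] H} (h : IsCommutator D T C) (h' : IsCommutator D T C') : C = C' := by
  refine ContinuousLinearMap.ext_on (s := (D.domain : Set H)) ?_ ?_
  · simpa using hD
  · intro x hx
    obtain ⟨_, h1⟩ := h ⟨x, hx⟩
    obtain ⟨_, h2⟩ := h' ⟨x, hx⟩
    rw [h1, h2]

theorem IsCommutator.add {D : H →ₗ.[ℂ] H} {T T' C C' : H →L[ℂ] H}
    (h : IsCommutator D T C) (h' : IsCommutator D T' C') :
    IsCommutator D (T + T') (C + C') := by
  intro x
  obtain ⟨m1, h1⟩ := h x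
  obtain ⟨m2, h2⟩ := h' x
  refine ⟨D.domain.add_mem m1 m2, ?_⟩
  have : D ⟨(T + T') x, D.domain.add_mem m1 m2⟩ = D ⟨T x, m1⟩ + D ⟨T' x, m2⟩ := by
    rw [← LinearPMap.map_add]; rfl
  rw [this]
  simp only [add_apply, h1, h2]
  abel

theorem IsCommutator.smul {D : H →ₗ.[ℂ] H} {T C : H →L[ℂ] H} (c : ℂ)
    (h : IsCommutator D T C) : IsCommutator D (c • T) (c • C) := by
  intro x
  obtain ⟨m1, h1⟩ := h x
  refine ⟨D.domain.smul_mem c m1, ?_⟩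
  have : D ⟨(c • T) x, D.domain.smul_mem c m1⟩ = c • D ⟨T x, m1⟩ := by
    rw [← LinearPMap.map_smul]; rfl
  rw [this]
  simp only [smul_apply, h1, smul_sub]

theorem IsCommutator.mul {D : H →ₗ.[ℂ] H} {T T' C C' : H →L[ℂ] H}
    (h : IsCommutator D T C) (h' : IsCommutator D T' C') :
    IsCommutator D (T * T') (C * T' + T * C') := by
  intro x
  obtain ⟨m2, h2⟩ := h' x
  obtain ⟨m1, h1⟩ := h ⟨T' x, m2⟩
  refine ⟨m1, ?_⟩
  change C (T' x) + T (C' x) = D ⟨T (T' x), m1⟩ - T (T' (D x))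
  rw [h2, map_sub]
  have h1' : C (T' x) = D ⟨T (T' x), m1⟩ - T (D ⟨T' x, m2⟩) := h1
  rw [h1']
  abel

theorem IsCommutator.one (D : H →ₗ.[ℂ] H) : IsCommutator D 1 0 :=
  fun x => ⟨x.2, by simp⟩

end Commutator

/-! ### Spectral triples -/

/-- A spectral triple over the unital `*`-algebra `A` on the Hilbert space `H`: a unital
`*`-representation of `A`, and a self-adjoint operator `D` with compact resolvent (the operator
`(D - i)⁻¹` is everywhere defined and compact) having bounded commutators with `A`. -/
structure SpectralTriple (A H : Type*) [Ring A] [Algebra ℂ A] [StarRing A] [StarModule ℂ A]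
    [NormedAddCommGroup H] [InnerProductSpace ℂ H] [CompleteSpace H] where
  rep : A →⋆ₐ[ℂ] (H →L[ℂ] H)
  D : H →ₗ.[ℂ] H
  selfAdjoint : IsSelfAdjoint D
  compactResolvent : ∃ R : H →L[ℂ] H, IsCompactOperator R ∧
    (∀ x : H, ∃ h : R x ∈ D.domain, D ⟨R x, h⟩ - Complex.I • R x = x) ∧
    ∀ x : D.domain, R (D x - Complex.I • (x : H)) = x
  bounded : ∀ a : A, ∃ C : H →L[ℂ] H, IsCommutator D (rep a) C

/-- The sign of a self-adjoint operator `D` with compact resolvent, with the convention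
`sign 0 = 1`: the operator `2 P - 1`, where `P` is the orthogonal projection onto the closed linear
span of the eigenvectors of `D` with eigenvalue `≥ 0`. -/
def signOp {H : Type*} [NormedAddCommGroup H] [InnerProductSpace ℂ H] [CompleteSpace H]
    (D : H →ₗ.[ℂ] H) : H →L[ℂ] H :=
  (2 : ℂ) • (Submodule.span ℂ
    {x : H | ∃ t : ℝ, 0 ≤ t ∧ ∃ h : x ∈ D.domain, D ⟨x, h⟩ = (t : ℂ) • x}).topologicalClosure.starProjection
    - 1

/-! ### Connes' calculus -/

section Calculus

/-- The part of a spectral triple over a unital algebra `B` that enters the definition of its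
differential forms: a unital representation and a densely defined operator with bounded
commutators. -/
structure DiracData (B H : Type*) [Ring B] [Algebra ℂ B]
    [NormedAddCommGroup H] [InnerProductSpace ℂ H] where
  rep : B →ₐ[ℂ] (H →L[ℂ] H)
  D : H →ₗ.[ℂ] H
  dense : Dense (D.domain : Set H)
  bounded : ∀ b : B, ∃ C : H →L[ℂ] H, IsCommutator D (rep b) C

/-- The quotient space `B / ℂ 1`. -/
abbrev RedAlg (B : Type*) [Ring B] [Algebra ℂ B] : Type _ :=
  B ⧸ Submodule.span ℂ {(1 : B)}

/-- The reduced universal forms `Ωⁿ(B) = B ⊗ (B / ℂ 1)^{⊗ n}` of a unital algebra `B`. -/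
def UForm (B : Type*) [Ring B] [Algebra ℂ B] (n : ℕ) : Type _ :=
  B ⊗[ℂ] (⨂[ℂ]^n (RedAlg B))

instance (B : Type*) [Ring B] [Algebra ℂ B] (n : ℕ) : AddCommGroup (UForm B n) :=
  inferInstanceAs (AddCommGroup (B ⊗[ℂ] (⨂[ℂ]^n (RedAlg B))))

instance (B : Type*) [Ring B] [Algebra ℂ B] (n : ℕ) : Module ℂ (UForm B n) :=
  inferInstanceAs (Module ℂ (B ⊗[ℂ] (⨂[ℂ]^n (RedAlg B))))

/-- The universal form `b₀ db₁ ⋯ dbₙ = b₀ ⊗ b̄₁ ⊗ ⋯ ⊗ b̄ₙ`. -/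
def uform {B : Type*} [Ring B] [Algebra ℂ B] {n : ℕ} (b₀ : B) (b : Fin n → B) : UForm B n :=
  b₀ ⊗ₜ[ℂ] PiTensorProduct.tprod ℂ
    (fun i => (Submodule.span ℂ {(1 : B)}).mkQ (b i))

/-- The universal differential `b₀ ⊗ b̄₁ ⊗ ⋯ ⊗ b̄ₙ ↦ 1 ⊗ b̄₀ ⊗ b̄₁ ⊗ ⋯ ⊗ b̄ₙ`. -/
def udiff (B : Type*) [Ring B] [Algebra ℂ B] (n : ℕ) : UForm B n →ₗ[ℂ] UForm B (n + 1) :=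
  ((TensorProduct.mk ℂ B (⨂[ℂ]^(n + 1) (RedAlg B)) 1).comp
    (TensorProduct.lift
      (((PiTensorProduct.lift (R := ℂ) (s := fun _ : Fin n => RedAlg B)
          (E := ⨂[ℂ]^(n + 1) (RedAlg B))).toLinearMap.comp
        (PiTensorProduct.tprod ℂ (s := fun _ : Fin (n + 1) => RedAlg B)).curryLeft).comp
        (Submodule.span ℂ {(1 : B)}).mkQ)) :
    B ⊗[ℂ] (⨂[ℂ]^n (RedAlg B)) →ₗ[ℂ] B ⊗[ℂ] (⨂[ℂ]^(n + 1) (RedAlg B)))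

/-- The space `𝓑(H) / 𝓚(H)`. -/
abbrev Calkin (H : Type*) [NormedAddCommGroup H] [InnerProductSpace ℂ H] : Type _ :=
  (H →L[ℂ] H) ⧸ compactOperator (RingHom.id ℂ) H H

/-- The quotient map `𝓑(H) → 𝓑(H) / 𝓚(H)`. -/
def toCalkin (H : Type*) [NormedAddCommGroup H] [InnerProductSpace ℂ H] :
    (H →L[ℂ] H) →ₗ[ℂ] Calkin H :=
  (compactOperator (RingHom.id ℂ) H H).mkQ

theorem udiff_uform {B : Type*} [Ring B] [Algebra ℂ B] {n : ℕ} (b₀ : B) (b : Fin n → B) :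
    udiff B n (uform b₀ b) = uform 1 (Fin.cons b₀ b) := by
  change TensorProduct.mk _ _ _ _ (TensorProduct.lift _ (_ ⊗ₜ[ℂ] _)) = _
  rw [TensorProduct.lift.tmul]
  simp only [LinearMap.comp_apply, LinearEquiv.coe_coe, PiTensorProduct.lift.tprod, uform]
  change _ ⊗ₜ[ℂ] _ = _
  rw [MultilinearMap.curryLeft_apply]
  congr 2
  funext i
  refine Fin.cases ?_ (fun i => ?_) i <;> rfl

variable {B H : Type*} [Ring B] [Algebra ℂ B] [NormedAddCommGroup H] [InnerProductSpace ℂ H]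

namespace DiracData

/-- The bounded operator `[D, b]`. -/
def comm (X : DiracData B H) (b : B) : H →L[ℂ] H := (X.bounded b).choose

theorem isCommutator_comm (X : DiracData B H) (b : B) :
    IsCommutator X.D (X.rep b) (X.comm b) := (X.bounded b).choose_spec

/-- The linear map `b ↦ [D, b]`. -/
def commLin (X : DiracData B H) : B →ₗ[ℂ] (H →L[ℂ] H) where
  toFun := X.comm
  map_add' a b := (X.isCommutator_comm (a + b)).unique X.dense
    (by simpa using (X.isCommutator_comm a).add (X.isCommutator_comm b))
  map_smul' c b := (X.isCommutator_comm (c • b)).unique X.dense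
    (by simpa using (X.isCommutator_comm b).smul c)

/-- The map `b̄ ↦ [D, b]` on `B / ℂ 1`. -/
def commBar (X : DiracData B H) : RedAlg B →ₗ[ℂ] (H →L[ℂ] H) :=
  (Submodule.span ℂ {(1 : B)}).liftQ X.commLin <| by
    rw [Submodule.span_le, Set.singleton_subset_iff]
    exact (X.isCommutator_comm 1).unique X.dense (by simpa using IsCommutator.one X.D)

/-- The linear map `b₀ ⊗ b̄₁ ⊗ ⋯ ⊗ b̄ₙ ↦ b₀ [D, b₁] ⋯ [D, bₙ]` into the bounded operators. -/
def piOp (X : DiracData B H) (n : ℕ) : UForm B n →ₗ[ℂ] (H →L[ℂ] H) :=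
  (TensorProduct.lift
    ((LinearMap.mul ℂ (H →L[ℂ] H)).compl₁₂ X.rep.toLinearMap
      (PiTensorProduct.lift
        ((MultilinearMap.mkPiAlgebraFin ℂ n (H →L[ℂ] H)).compLinearMap fun _ => X.commBar))) :
    B ⊗[ℂ] (⨂[ℂ]^n (RedAlg B)) →ₗ[ℂ] (H →L[ℂ] H))

theorem piOp_uform (X : DiracData B H) {n : ℕ} (b₀ : B) (b : Fin n → B) :
    X.piOp n (uform b₀ b) = X.rep b₀ * (List.ofFn fun i => X.comm (b i)).prod := by
  change TensorProduct.lift _ (_ ⊗ₜ[ℂ] _) = _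
  rw [TensorProduct.lift.tmul, LinearMap.compl₁₂_apply, PiTensorProduct.lift.tprod,
    MultilinearMap.compLinearMap_apply, MultilinearMap.mkPiAlgebraFin_apply]
  rfl

/-- The representation `π : b₀ ⊗ b̄₁ ⊗ ⋯ ⊗ b̄ₙ ↦ b₀ [D, b₁] ⋯ [D, bₙ] + 𝓚(H)`. -/
def pi (X : DiracData B H) (n : ℕ) : UForm B n →ₗ[ℂ] Calkin H :=
  (toCalkin H).comp (X.piOp n)

/-- `J₀ⁿ`, the kernel of `π` in degree `n`. -/
def J₀ (X : DiracData B H) (n : ℕ) : Submodule ℂ (UForm B n) := LinearMap.ker (X.pi n)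

/-- `Jⁿ = J₀ⁿ + d J₀ⁿ⁻¹`, with `J₀⁻¹ = 0`. -/
def J (X : DiracData B H) : (n : ℕ) → Submodule ℂ (UForm B n)
  | 0 => X.J₀ 0
  | n + 1 => X.J₀ (n + 1) ⊔ (X.J₀ n).map (udiff B n)

/-- Connes' calculus `Ω_Dⁿ(B) = Ωⁿ(B) / Jⁿ` of a unital algebra. -/
abbrev Omega (X : DiracData B H) (n : ℕ) : Type _ := UForm B n ⧸ X.J n

/-- The class of `b₀ db₁ ⋯ dbₙ` in `Ω_Dⁿ(B)`. -/
def omegaMk (X : DiracData B H) {n : ℕ} (b₀ : B) (b : Fin n → B) : X.Omega n :=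
  (X.J n).mkQ (uform b₀ b)

/-- The data induced on the minimal unitization of a (nonunital) subalgebra `S` of `B`, which is
represented by `(s, c) ↦ s + c 1`. -/
def unitization (X : DiracData B H) (S : NonUnitalSubalgebra ℂ B) :
    DiracData (Unitization ℂ S) H where
  rep := X.rep.comp (Unitization.lift (NonUnitalSubalgebraClass.subtype S))
  D := X.D
  dense := X.dense
  bounded _ := X.bounded _

/-- The universal forms `Ωⁿ(S)` of a nonunital algebra `S`: the subspace of the universal forms of
its minimal unitization spanned by the forms `(s₀, 0) d(s₁, 0) ⋯ d(sₙ, 0)`. -/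
def nuForm (S : NonUnitalSubalgebra ℂ B) (n : ℕ) : Submodule ℂ (UForm (Unitization ℂ S) n) :=
  Submodule.span ℂ {ω | ∃ (s₀ : S) (s : Fin n → S),
    ω = uform (Unitization.inr s₀) (fun i => Unitization.inr (s i))}

/-- Connes' calculus `Ω_Dⁿ(S) = Ωⁿ(S) / (Ωⁿ(S) ∩ Jⁿ)` of a nonunital subalgebra `S`, where `Jⁿ` is
that of the minimal unitization of `S`. -/
abbrev NuOmega (X : DiracData B H) (S : NonUnitalSubalgebra ℂ B) (n : ℕ) : Type _ :=
  nuForm S n ⧸ ((X.unitization S).J n).submoduleOf (nuForm S n)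

/-- The class of `s₀ ds₁ ⋯ dsₙ` in `Ω_Dⁿ(S)`. -/
def nuOmegaMk (X : DiracData B H) (S : NonUnitalSubalgebra ℂ B) {n : ℕ} (s₀ : S)
    (s : Fin n → S) : X.NuOmega S n :=
  (((X.unitization S).J n).submoduleOf (nuForm S n)).mkQ
    ⟨uform (Unitization.inr s₀) (fun i => Unitization.inr (s i)),
      Submodule.subset_span ⟨s₀, s, rfl⟩⟩

end DiracData

end Calculus

/-! ### Operators on `ℓ²(ℕ)` -/

/-- The Hilbert space `ℓ²(ℕ)`. -/
abbrev L2 : Type := lp (fun _ : ℕ => ℂ) 2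

/-- The standard orthonormal basis of `ℓ²(ℕ)`. -/
def e (n : ℕ) : L2 := lp.single 2 n (1 : ℂ)

theorem inner_e (n : ℕ) (v : L2) : ⟪e n, v⟫_ℂ = v n := by
  rw [e, lp.inner_single_left]; simp

/-- The left shift `(v₀, v₁, …) ↦ (v₁, v₂, …)`, so that `l e₀ = 0` and `l eₙ₊₁ = eₙ`. -/
def shift : L2 →L[ℂ] L2 :=
  LinearMap.mkContinuous
    { toFun := fun v => ⟨fun n => v (n + 1), by
        have h := (memℓp_gen_iff (p := 2) (by simp)).1 v.2
        exact memℓp_gen ((summable_nat_add_iff 1).2 h)⟩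
      map_add' := fun _ _ => rfl
      map_smul' := fun _ _ => rfl } 1 <| by
    intro v
    rw [one_mul]
    refine lp.norm_le_of_forall_sum_le (by simp) (norm_nonneg _) fun s => ?_
    have := lp.sum_rpow_le_norm_rpow (p := 2) (by simp) v (s.map (addRightEmbedding 1))
    rw [Finset.sum_map] at this
    exact this

theorem shift_apply (v : L2) (n : ℕ) : shift v n = v (n + 1) := rfl

/-- The elementary matrix `eᵢⱼ`, i.e. the operator `v ↦ vⱼ eᵢ`. -/
def matUnit (i j : ℕ) : L2 →L[ℂ] L2 := (lp.evalCLM ℂ (fun _ : ℕ => ℂ) 2 j).smulRight (e i)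

theorem matUnit_apply (i j : ℕ) (v : L2) : matUnit i j v = v j • e i := rfl

/-- The space `𝓢` of finitely supported matrices in `𝓑(ℓ²(ℕ))`. -/
def finMat : Submodule ℂ (L2 →L[ℂ] L2) :=
  Submodule.span ℂ (Set.range fun p : ℕ × ℕ => matUnit p.1 p.2)

theorem finMat_mul {S T : L2 →L[ℂ] L2} (hS : S ∈ finMat) (hT : T ∈ finMat) : S * T ∈ finMat := by
  have h : finMat * finMat ≤ finMat := by
    rw [finMat, Submodule.span_mul_span, Submodule.span_le]
    rintro _ ⟨_, ⟨p, rfl⟩, _, ⟨q, rfl⟩, rfl⟩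
    have : matUnit p.1 p.2 * matUnit q.1 q.2 = (e q.1 p.2) • matUnit p.1 q.2 := by
      ext1 v
      simp [matUnit_apply, smul_smul, mul_comm]
    simp only [this]
    exact Submodule.smul_mem _ _ (Submodule.subset_span ⟨(p.1, q.2), rfl⟩)
  exact h (Submodule.mul_mem_mul hS hT)

/-- The operator `lⁿ` for `n ≥ 0`, and `(l*)⁻ⁿ` for `n < 0`. -/
def shiftZ (n : ℤ) : L2 →L[ℂ] L2 :=
  if 0 ≤ n then shift ^ n.toNat else (ContinuousLinearMap.adjoint shift) ^ (-n).toNat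

/-- The linear splitting `σ'` of the symbol map on Laurent polynomials:
`∑ cₙ zⁿ ↦ ∑_{n ≥ 0} cₙ lⁿ + ∑_{n > 0} c₋ₙ (l*)ⁿ`. -/
def sigma' (f : ℂ[T;T⁻¹]) : L2 →L[ℂ] L2 := f.coeff.sum fun n c => c • shiftZ n

/-! ### The quantum double suspension -/

section Suspension

variable (H : Type*) [NormedAddCommGroup H] [InnerProductSpace ℂ H]

/-- The Hilbert space tensor product `H ⊗ ℓ²(ℕ)`. -/
abbrev HL2 : Type _ := UniformSpace.Completion (H ⊗[ℂ] L2)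

variable {H}

/-- The operator `S ⊗ T` on `H ⊗ ℓ²(ℕ)`. -/
def opTensor (S : H →L[ℂ] H) (T : L2 →L[ℂ] L2) : HL2 H →L[ℂ] HL2 H :=
  (TensorProduct.mapL S T).completion

theorem opTensor_coe (S : H →L[ℂ] H) (T : L2 →L[ℂ] L2) (h : H) (v : L2) :
    opTensor S T ((h ⊗ₜ[ℂ] v : H ⊗[ℂ] L2) : HL2 H) = ((S h ⊗ₜ[ℂ] T v : H ⊗[ℂ] L2) : HL2 H) := by
  rw [opTensor, ContinuousLinearMap.completion_apply_coe, TensorProduct.mapL_tmul]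

theorem ext_HL2 {E : Type*} [NormedAddCommGroup E] [NormedSpace ℂ E] {S T : HL2 H →L[ℂ] E}
    (h : ∀ (x : H) (v : L2), S ((x ⊗ₜ[ℂ] v : H ⊗[ℂ] L2) : HL2 H)
      = T ((x ⊗ₜ[ℂ] v : H ⊗[ℂ] L2) : HL2 H)) : S = T := by
  ext1 y
  induction y using UniformSpace.Completion.induction_on with
  | hp => exact isClosed_eq S.continuous T.continuous
  | ih y =>
    induction y using TensorProduct.induction_on with
    | zero => rw [UniformSpace.Completion.coe_zero, map_zero, map_zero]
    | tmul x v => exact h x v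
    | add y z hy hz => simp only [UniformSpace.Completion.coe_add, map_add, hy, hz]

theorem opTensor_mul (S S' : H →L[ℂ] H) (T T' : L2 →L[ℂ] L2) :
    opTensor S T * opTensor S' T' = opTensor (S * S') (T * T') :=
  ext_HL2 fun x v => by
    change opTensor S T (opTensor S' T' _) = _
    simp only [opTensor_coe, mul_apply_eq_comp]

/-- The amplification `S ↦ S ⊗ 1`. -/
def ampLeft : (H →L[ℂ] H) →ₐ[ℂ] (HL2 H →L[ℂ] HL2 H) :=
  AlgHom.ofLinearMap
    { toFun := fun S => opTensor S 1
      map_add' := fun S S' => ext_HL2 fun x v => by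
        simp [opTensor_coe, TensorProduct.add_tmul, UniformSpace.Completion.coe_add]
      map_smul' := fun c S => ext_HL2 fun x v => by
        simp [opTensor_coe, ← TensorProduct.smul_tmul'] }
    (ext_HL2 fun x v => opTensor_coe 1 1 x v)
    (fun S S' => by simp [opTensor_mul])

/-- The amplification `T ↦ 1 ⊗ T`. -/
def ampRight : (L2 →L[ℂ] L2) →ₐ[ℂ] (HL2 H →L[ℂ] HL2 H) :=
  AlgHom.ofLinearMap
    { toFun := fun T => opTensor 1 T
      map_add' := fun S S' => ext_HL2 fun x v => by
        simp [opTensor_coe, TensorProduct.tmul_add, UniformSpace.Completion.coe_add]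
      map_smul' := fun c S => ext_HL2 fun x v => by
        simp [opTensor_coe] }
    (ext_HL2 fun x v => opTensor_coe 1 1 x v)
    (fun S S' => by simp [opTensor_mul])

/-- The isometry `h ↦ h ⊗ eₙ`. -/
def incl (n : ℕ) : H →L[ℂ] HL2 H :=
  (UniformSpace.Completion.toComplL (𝕜 := ℂ) (E := H ⊗[ℂ] L2)).comp
    ((TensorProduct.mkL ℂ H L2).flip (e n))

theorem incl_apply (n : ℕ) (h : H) : incl n h = ((h ⊗ₜ[ℂ] e n : H ⊗[ℂ] L2) : HL2 H) := rfl

variable [CompleteSpace H]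

/-- The `n`-th component of a vector of `H ⊗ ℓ²(ℕ)`: the adjoint of `h ↦ h ⊗ eₙ`. -/
def slice (n : ℕ) : HL2 H →L[ℂ] H := ContinuousLinearMap.adjoint (incl n)

theorem slice_coe (n : ℕ) (h : H) (v : L2) :
    slice n ((h ⊗ₜ[ℂ] v : H ⊗[ℂ] L2) : HL2 H) = v n • h := by
  refine ext_inner_left ℂ fun k => ?_
  rw [slice, ContinuousLinearMap.adjoint_inner_right, incl_apply,
    UniformSpace.Completion.inner_coe, TensorProduct.inner_tmul, inner_e, inner_smul_right,
    mul_comm]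

theorem slice_ext {x y : HL2 H} (h : ∀ n, slice n x = slice n y) : x = y := by
  suffices hz : ∀ z : HL2 H, (∀ n, slice n z = 0) → z = 0 by
    exact sub_eq_zero.1 (hz _ fun n => by rw [map_sub, h, sub_self])
  intro z hz
  suffices hS : innerSL ℂ z = 0 by
    have := congrArg (fun S => S z) hS
    simpa using this
  refine ext_HL2 fun k v => ?_
  let G : L2 →L[ℂ] ℂ := (innerSL ℂ z).comp
    ((UniformSpace.Completion.toComplL (𝕜 := ℂ) (E := H ⊗[ℂ] L2)).comp
      (TensorProduct.mkL ℂ H L2 k))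
  have hG : ∀ n, G (e n) = 0 := by
    intro n
    have h1 : ⟪z, incl n k⟫_ℂ = 0 := by
      rw [← ContinuousLinearMap.adjoint_inner_left]
      change ⟪slice n z, k⟫_ℂ = 0
      rw [hz, inner_zero_left]
    exact h1
  have hG0 : G = 0 := by
    refine lp.ext_continuousLinearMap (by simp) fun n => ?_
    ext1
    simpa [e] using hG n
  exact congrArg (fun S => S v) hG0

/-- The graph of `D ⊗ 1 + F ⊗ N`, where `N eₙ = n eₙ`: the pairs `(x, y)` such that each component
`xₙ` of `x` lies in the domain of `D` and `yₙ = D xₙ + n F xₙ`. -/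
def suspGraph (D : H →ₗ.[ℂ] H) (F : H →L[ℂ] H) : Submodule ℂ (HL2 H × HL2 H) where
  carrier := {p | ∀ n : ℕ, ∃ h : slice n p.1 ∈ D.domain,
    slice n p.2 = D ⟨slice n p.1, h⟩ + (n : ℂ) • F (slice n p.1)}
  zero_mem' n := ⟨by simp, by
    have : (⟨slice n (0 : HL2 H × HL2 H).1, by simp⟩ : D.domain) = 0 := by ext; simp
    rw [this]; simp⟩
  add_mem' {p q} hp hq n := by
    obtain ⟨a, ha⟩ := hp n
    obtain ⟨b, hb⟩ := hq n
    have hm : slice n (p + q).1 ∈ D.domain := by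
      rw [Prod.fst_add, map_add]; exact D.domain.add_mem a b
    refine ⟨hm, ?_⟩
    have : (⟨slice n (p + q).1, hm⟩ : D.domain) = ⟨slice n p.1, a⟩ + ⟨slice n q.1, b⟩ := by
      ext; simp
    rw [this, LinearPMap.map_add]
    simp only [Prod.snd_add, Prod.fst_add, map_add, ha, hb, smul_add]
    abel
  smul_mem' c p hp n := by
    obtain ⟨a, ha⟩ := hp n
    have hm : slice n (c • p).1 ∈ D.domain := by
      rw [Prod.smul_fst, map_smul]; exact D.domain.smul_mem c a
    refine ⟨hm, ?_⟩
    have : (⟨slice n (c • p).1, hm⟩ : D.domain) = c • ⟨slice n p.1, a⟩ := by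
      ext; simp
    rw [this, LinearPMap.map_smul]
    simp only [Prod.smul_snd, Prod.smul_fst, map_smul, ha, smul_add, smul_comm c]

/-- The operator `D ⊗ 1 + F ⊗ N` on `H ⊗ ℓ²(ℕ)`, on its natural (maximal) domain. -/
def suspOp (D : H →ₗ.[ℂ] H) (F : H →L[ℂ] H) : HL2 H →ₗ.[ℂ] HL2 H :=
  (suspGraph D F).toLinearPMap

theorem suspGraph_functional (D : H →ₗ.[ℂ] H) (F : H →L[ℂ] H) (p : HL2 H × HL2 H)
    (hp : p ∈ suspGraph D F) (h0 : p.1 = 0) : p.2 = 0 := by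
  refine slice_ext fun n => ?_
  obtain ⟨h, hn⟩ := hp n
  have : (⟨slice n p.1, h⟩ : D.domain) = 0 := by ext; simp [h0]
  rw [hn, this]
  simp [h0]

theorem graph_suspOp (D : H →ₗ.[ℂ] H) (F : H →L[ℂ] H) : (suspOp D F).graph = suspGraph D F :=
  Submodule.toLinearPMap_graph_eq _ (suspGraph_functional D F)


theorem slice_incl (n m : ℕ) (h : H) : slice n (incl m h) = if n = m then h else 0 := by
  rw [incl_apply, slice_coe, e, lp.single_apply]
  split_ifs with h1
  · subst h1; simp
  · simp [Pi.single_eq_of_ne h1]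

theorem incl_mem_suspOp (D : H →ₗ.[ℂ] H) (F : H →L[ℂ] H) (n : ℕ) {h : H} (hh : h ∈ D.domain) :
    incl n h ∈ (suspOp D F).domain := by
  rw [LinearPMap.mem_domain_iff]
  refine ⟨incl n (D ⟨h, hh⟩ + (n : ℂ) • F h), ?_⟩
  rw [graph_suspOp]
  intro m
  by_cases hm : m = n
  · subst hm
    refine ⟨by simpa [slice_incl] using hh, ?_⟩
    simp [slice_incl]
  · refine ⟨by simp [slice_incl, hm], ?_⟩
    have : (⟨slice m (incl n h, incl n (D ⟨h, hh⟩ + (n : ℂ) • F h)).1,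
        by simp [slice_incl, hm]⟩ : D.domain) = 0 := by
      ext; simp [slice_incl, hm]
    rw [this]
    simp [slice_incl, hm]

theorem dense_suspOp {D : H →ₗ.[ℂ] H} (hD : Dense (D.domain : Set H)) (F : H →L[ℂ] H) :
    Dense ((suspOp D F).domain : Set (HL2 H)) := by
  rw [Submodule.dense_iff_topologicalClosure_eq_top, Submodule.topologicalClosure_eq_top_iff,
    Submodule.eq_bot_iff]
  intro y hy
  refine slice_ext fun n => ?_
  rw [map_zero]
  refine hD.eq_zero_of_inner_right ℂ fun h hh => ?_
  have h1 := hy _ (incl_mem_suspOp D F n hh)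
  rwa [slice, ContinuousLinearMap.adjoint_inner_right]

theorem suspOp_mem {D : H →ₗ.[ℂ] H} {F : H →L[ℂ] H} (x : (suspOp D F).domain) :
    ((x : HL2 H), suspOp D F x) ∈ suspGraph D F := by
  rw [← graph_suspOp]; exact LinearPMap.mem_graph _ x

/-- A criterion for bounded commutators with `D ⊗ 1 + F ⊗ N`. -/
theorem isCommutator_suspOp {D : H →ₗ.[ℂ] H} {F : H →L[ℂ] H} {T C : HL2 H →L[ℂ] HL2 H}
    (h : ∀ p ∈ suspGraph D F, (T p.1, C p.1 + T p.2) ∈ suspGraph D F) :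
    IsCommutator (suspOp D F) T C := by
  intro x
  have h1 := h _ (suspOp_mem x)
  rw [← graph_suspOp, LinearPMap.mem_graph_iff] at h1
  obtain ⟨y, hy1, hy2⟩ := h1
  have hm : T x ∈ (suspOp D F).domain := by
    have : T x = y := hy1.symm
    rw [this]; exact y.2
  refine ⟨hm, ?_⟩
  have : (⟨T x, hm⟩ : (suspOp D F).domain) = y := Subtype.ext hy1.symm
  rw [this, hy2, add_sub_cancel_right]

theorem slice_opTensor_matUnit (S : H →L[ℂ] H) (i j n : ℕ) (x : HL2 H) :
    slice n (opTensor S (matUnit i j) x) = if n = i then S (slice j x) else 0 := by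
  have : (slice n).comp (opTensor S (matUnit i j))
      = if n = i then S.comp (slice j) else 0 := by
    refine ext_HL2 fun h v => ?_
    rw [ContinuousLinearMap.comp_apply, opTensor_coe, slice_coe, matUnit_apply]
    split_ifs with hn
    · subst hn
      simp [slice_coe, e]
    · simp [e, Pi.single_eq_of_ne hn]
  have := congrArg (fun R => R x) this
  split_ifs at this ⊢ <;> exact this

theorem slice_opTensor_shift (S : H →L[ℂ] H) (n : ℕ) (x : HL2 H) :
    slice n (opTensor S shift x) = S (slice (n + 1) x) := by
  have : (slice n).comp (opTensor S shift) = S.comp (slice (n + 1)) := by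
    refine ext_HL2 fun h v => ?_
    simp [opTensor_coe, slice_coe, shift_apply]
  exact congrArg (fun R => R x) this

theorem adjoint_shift_apply (v : L2) (n : ℕ) :
    (ContinuousLinearMap.adjoint shift) v n = if n = 0 then 0 else v (n - 1) := by
  rw [← inner_e, ContinuousLinearMap.adjoint_inner_right]
  cases n with
  | zero =>
    have : shift (e 0) = 0 := by
      ext n; simp [shift_apply, e]
    simp [this]
  | succ n =>
    have : shift (e (n + 1)) = e n := by
      ext m
      simp only [shift_apply, e, lp.single_apply, Pi.single_apply, add_left_inj]
    simp [this, inner_e]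

theorem slice_opTensor_adjoint_shift (S : H →L[ℂ] H) (n : ℕ) (x : HL2 H) :
    slice n (opTensor S (ContinuousLinearMap.adjoint shift) x)
      = if n = 0 then 0 else S (slice (n - 1) x) := by
  have : (slice n).comp (opTensor S (ContinuousLinearMap.adjoint shift))
      = if n = 0 then 0 else S.comp (slice (n - 1)) := by
    refine ext_HL2 fun h v => ?_
    rw [ContinuousLinearMap.comp_apply, opTensor_coe, slice_coe, adjoint_shift_apply]
    split_ifs with hn <;> simp [slice_coe]
  have := congrArg (fun R => R x) this
  split_ifs at this ⊢ <;> exact this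

theorem isCommutator_matUnit {D : H →ₗ.[ℂ] H} (F : H →L[ℂ] H) {S C : H →L[ℂ] H}
    (hS : IsCommutator D S C) (i j : ℕ) :
    IsCommutator (suspOp D F) (opTensor S (matUnit i j))
      (opTensor (C + (i : ℂ) • (F * S) - (j : ℂ) • (S * F)) (matUnit i j)) := by
  refine isCommutator_suspOp fun p hp n => ?_
  by_cases hn : n = i
  · subst hn
    obtain ⟨hj, hj2⟩ := hp j
    obtain ⟨h1, h2⟩ := hS ⟨_, hj⟩
    simp only [map_add, slice_opTensor_matUnit, if_true]
    refine ⟨h1, ?_⟩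
    rw [hj2]
    have h2' : C (slice j p.1) = D ⟨S (slice j p.1), h1⟩ - S (D ⟨slice j p.1, hj⟩) := h2
    simp only [add_apply, sub_apply, smul_apply, mul_apply_eq_comp, h2', map_add, map_smul]
    abel
  · simp only [map_add, slice_opTensor_matUnit, if_neg hn]
    exact ⟨D.domain.zero_mem, by
      have : (⟨0, D.domain.zero_mem⟩ : D.domain) = 0 := rfl
      rw [this]; simp⟩

theorem isCommutator_shift (D : H →ₗ.[ℂ] H) (F : H →L[ℂ] H) :
    IsCommutator (suspOp D F) (opTensor 1 shift) (opTensor (-F) shift) := by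
  refine isCommutator_suspOp fun p hp n => ?_
  obtain ⟨h, h2⟩ := hp (n + 1)
  simp only [map_add, slice_opTensor_shift]
  refine ⟨h, ?_⟩
  rw [h2]
  simp only [neg_apply, one_apply_eq_self, Nat.cast_add, Nat.cast_one, add_smul,
    one_smul]
  abel

theorem isCommutator_adjoint_shift (D : H →ₗ.[ℂ] H) (F : H →L[ℂ] H) :
    IsCommutator (suspOp D F) (opTensor 1 (ContinuousLinearMap.adjoint shift))
      (opTensor F (ContinuousLinearMap.adjoint shift)) := by
  refine isCommutator_suspOp fun p hp n => ?_
  cases n with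
  | zero =>
    simp only [map_add, slice_opTensor_adjoint_shift, if_true]
    exact ⟨D.domain.zero_mem, by
      have : (⟨0, D.domain.zero_mem⟩ : D.domain) = 0 := rfl
      rw [this]; simp⟩
  | succ n =>
    obtain ⟨h, h2⟩ := hp n
    simp only [map_add, slice_opTensor_adjoint_shift, Nat.add_one_ne_zero, if_false,
      Nat.add_sub_cancel]
    refine ⟨h, ?_⟩
    rw [h2]
    simp only [one_apply_eq_self, Nat.cast_add, Nat.cast_one, add_smul, one_smul]
    abel

end Suspension

/-! ### The quantum double suspension -/

section QDS

/-- The algebra `A ⊗ 𝓑(ℓ²(ℕ))` (algebraic tensor product over `ℂ`). -/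
def TensorB (A : Type*) [Ring A] [Algebra ℂ A] : Type _ := A ⊗[ℂ] (L2 →L[ℂ] L2)

instance (A : Type*) [Ring A] [Algebra ℂ A] : Ring (TensorB A) :=
  inferInstanceAs (Ring (A ⊗[ℂ] (L2 →L[ℂ] L2)))

instance (A : Type*) [Ring A] [Algebra ℂ A] : Algebra ℂ (TensorB A) :=
  inferInstanceAs (Algebra ℂ (A ⊗[ℂ] (L2 →L[ℂ] L2)))

/-- The bilinear map `(a, T) ↦ a ⊗ T`. -/
def tens (A : Type*) [Ring A] [Algebra ℂ A] : A →ₗ[ℂ] (L2 →L[ℂ] L2) →ₗ[ℂ] TensorB A :=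
  (TensorProduct.mk ℂ A (L2 →L[ℂ] L2) : A →ₗ[ℂ] (L2 →L[ℂ] L2) →ₗ[ℂ] A ⊗[ℂ] (L2 →L[ℂ] L2))

theorem tens_mul {A : Type*} [Ring A] [Algebra ℂ A] (a b : A) (S T : L2 →L[ℂ] L2) :
    tens A a S * tens A b T = tens A (a * b) (S * T) :=
  Algebra.TensorProduct.tmul_mul_tmul a b S T

theorem tens_one {A : Type*} [Ring A] [Algebra ℂ A] : tens A 1 1 = 1 := rfl

/-- The subspace `A ⊗ 𝓢` of `A ⊗ 𝓑(ℓ²(ℕ))`. -/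
def tensorFinSpan (A : Type*) [Ring A] [Algebra ℂ A] : Submodule ℂ (TensorB A) :=
  Submodule.span ℂ {x | ∃ (a : A) (T : L2 →L[ℂ] L2), T ∈ finMat ∧ x = tens A a T}

theorem tensorFinSpan_mul {A : Type*} [Ring A] [Algebra ℂ A] {x y : TensorB A}
    (hx : x ∈ tensorFinSpan A) (hy : y ∈ tensorFinSpan A) : x * y ∈ tensorFinSpan A := by
  have h := Submodule.mul_mem_mul hx hy
  rw [tensorFinSpan, Submodule.span_mul_span] at h
  refine Submodule.span_mono ?_ h
  rintro _ ⟨_, ⟨a, S, hS, rfl⟩, _, ⟨b, T, hT, rfl⟩, rfl⟩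
  exact ⟨a * b, S * T, finMat_mul hS hT, tens_mul a b S T⟩

/-- The algebra `Σ²A`: the subalgebra of `A ⊗ 𝓑(ℓ²(ℕ))` generated by the `a ⊗ T`, with `T` a finitely
supported matrix, and the `1 ⊗ σ'(f)`, with `f` a Laurent polynomial. -/
def susp (A : Type*) [Ring A] [Algebra ℂ A] : Subalgebra ℂ (TensorB A) :=
  Algebra.adjoin ℂ
    ({x | ∃ (a : A) (T : L2 →L[ℂ] L2), T ∈ finMat ∧ x = tens A a T} ∪
      {x | ∃ f : ℂ[T;T⁻¹], x = tens A 1 (sigma' f)})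

/-- The (nonunital) subalgebra `A ⊗ 𝓢` of `Σ²A`. -/
def tensorFin (A : Type*) [Ring A] [Algebra ℂ A] : NonUnitalSubalgebra ℂ (susp A) where
  carrier := {x | (x : TensorB A) ∈ tensorFinSpan A}
  zero_mem' := (tensorFinSpan A).zero_mem
  add_mem' hx hy := (tensorFinSpan A).add_mem hx hy
  smul_mem' c _ hx := (tensorFinSpan A).smul_mem c hx
  mul_mem' hx hy := tensorFinSpan_mul hx hy

variable {A H : Type*} [Ring A] [Algebra ℂ A] [StarRing A] [StarModule ℂ A]
  [NormedAddCommGroup H] [InnerProductSpace ℂ H] [CompleteSpace H]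

namespace SpectralTriple

/-- The representation `a ⊗ T ↦ a ⊗ T` of `A ⊗ 𝓑(ℓ²(ℕ))` on `H ⊗ ℓ²(ℕ)`. -/
def tensorRep (X : SpectralTriple A H) : TensorB A →ₐ[ℂ] (HL2 H →L[ℂ] HL2 H) :=
  (Algebra.TensorProduct.lift (ampLeft.comp X.rep.toAlgHom) ampRight fun a T => by
    change opTensor _ 1 * opTensor 1 _ = opTensor 1 _ * opTensor _ 1
    simp [opTensor_mul] : A ⊗[ℂ] (L2 →L[ℂ] L2) →ₐ[ℂ] (HL2 H →L[ℂ] HL2 H))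

theorem tensorRep_tens (X : SpectralTriple A H) (a : A) (T : L2 →L[ℂ] L2) :
    X.tensorRep (tens A a T) = opTensor (X.rep a) T := by
  change opTensor _ 1 * opTensor 1 _ = _
  simp [opTensor_mul]

/-- The elements of `A ⊗ 𝓑(ℓ²(ℕ))` having bounded commutator with `D ⊗ 1 + F ⊗ N`. -/
def boundedSubalgebra (X : SpectralTriple A H) : Subalgebra ℂ (TensorB A) where
  carrier := {b | ∃ C, IsCommutator (suspOp X.D (signOp X.D)) (X.tensorRep b) C}
  add_mem' := by
    rintro a b ⟨C, hC⟩ ⟨C', hC'⟩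
    exact ⟨_, by rw [map_add]; exact hC.add hC'⟩
  mul_mem' := by
    rintro a b ⟨C, hC⟩ ⟨C', hC'⟩
    exact ⟨_, by rw [map_mul]; exact hC.mul hC'⟩
  algebraMap_mem' c := ⟨_, by
    rw [AlgHom.commutes, Algebra.algebraMap_eq_smul_one]
    exact (IsCommutator.one _).smul c⟩

theorem susp_le_boundedSubalgebra (X : SpectralTriple A H) : susp A ≤ X.boundedSubalgebra := by
  have hl : tens A 1 shift ∈ X.boundedSubalgebra :=
    ⟨_, by rw [tensorRep_tens, map_one]; exact isCommutator_shift _ _⟩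
  have hl' : tens A 1 (ContinuousLinearMap.adjoint shift) ∈ X.boundedSubalgebra :=
    ⟨_, by rw [tensorRep_tens, map_one]; exact isCommutator_adjoint_shift _ _⟩
  have hp : ∀ (T : L2 →L[ℂ] L2) (k : ℕ), tens A 1 T ∈ X.boundedSubalgebra →
      tens A 1 (T ^ k) ∈ X.boundedSubalgebra := by
    intro T k h
    induction k with
    | zero => rw [pow_zero, tens_one]; exact X.boundedSubalgebra.one_mem
    | succ k ih =>
      have := X.boundedSubalgebra.mul_mem ih h
      rwa [tens_mul, one_mul, ← pow_succ] at this
  refine Algebra.adjoin_le ?_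
  rintro x (⟨a, T, hT, rfl⟩ | ⟨f, rfl⟩)
  · induction hT using Submodule.span_induction with
    | mem T h =>
      obtain ⟨p, rfl⟩ := h
      obtain ⟨C, hC⟩ := X.bounded a
      exact ⟨_, by rw [tensorRep_tens]; exact isCommutator_matUnit _ hC _ _⟩
    | zero => rw [map_zero]; exact X.boundedSubalgebra.zero_mem
    | add S T _ _ hS hT => rw [map_add]; exact X.boundedSubalgebra.add_mem hS hT
    | smul c T _ hT => rw [map_smul]; exact X.boundedSubalgebra.smul_mem hT c
  · rw [sigma', Finsupp.sum, map_sum]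
    refine X.boundedSubalgebra.sum_mem fun n _ => ?_
    rw [map_smul]
    refine X.boundedSubalgebra.smul_mem ?_ _
    rw [shiftZ]
    split_ifs
    · exact hp _ _ hl
    · exact hp _ _ hl'

/-- The quantum double suspension: the algebra `Σ²A` represented on `H ⊗ ℓ²(ℕ)`, with the operator
`Σ²D = D ⊗ 1 + F ⊗ N`, where `F` is the sign of `D`. -/
def qds (X : SpectralTriple A H) : DiracData (susp A) (HL2 H) where
  rep := X.tensorRep.comp (susp A).val
  D := suspOp X.D (signOp X.D)
  dense := dense_suspOp X.selfAdjoint.dense_domain _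
  bounded b := X.susp_le_boundedSubalgebra b.2

end SpectralTriple

end QDS

end QDS

end

noncomputable section

namespace QDS

/-! ### Functoriality of the universal forms -/

section Functoriality

variable {B B' : Type*} [Ring B] [Algebra ℂ B] [Ring B'] [Algebra ℂ B']

/-! Write `B` for `Σ²A`, `S` for the ideal `A ⊗ 𝓢`, and `u` for `F ⊗ 1`. Modulo `S`, `B` is the
algebra of Laurent polynomials, split linearly by `σ(f) = 1 ⊗ σ'(f)`, and `[D, σ(f)] = u σ(-z f')`.
Hence the operator of every `n`-form on `B` is `u^n σ(f)` plus an operator `s₀[D, s₁]⋯[D, sₙ]`, or a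
sum of such, with all `sᵢ` in `S` (`exists_piOp_sub_mem_nuOp`). The question is what happens to the
symbol `f` modulo `J`.

In degree `n ≥ 2` every symbol is killed. The relation `d(z²) = 2z dz` holds for symbols but not for
universal forms, so it gives elements of `J₀` whose differentials realize every `u^n σ(f)` up to
operators of forms on `S` (`pow_mul_symbol_mem`). Hence the canonical map from the calculus of `S`
to that of `B` is onto.

In degree `1` the symbol survives. An element of `B` that acts compactly has zero symbol, so it lies
in `S` and its differential has zero symbol as well (`eq_zero_of_mem_J_one`). The analytic input is
that a Toeplitz operator which agrees with a compact operator far out has symbol zero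
(`eq_zero_of_isCompactOperator`).

Injectivity of the canonical map in positive degrees uses the local units `pₘ = 1 ⊗ Pₘ`, which
commute with `D`. If a form on `S` is `dη` modulo `J₀` with `η ∈ J₀` a form on `B`, cutting `η` down
by the `pₘ` gives a form on the unitization of `S` with operators `pₘ π(η)` and `pₘ π(dη)`. This
form does the same job as `η` (`piOp_truncateForm`, `mem_J_of_unitizationForm_mem_J`).

These arguments are carried out for an abstract extension (`IsLaurentExtension`), whose axioms are
then checked for the suspension. -/

theorem span_uform (n : ℕ) :
    Submodule.span ℂ {ω : UForm B n | ∃ b₀ b, ω = uform b₀ b} = ⊤ := by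
  rw [eq_top_iff]
  rintro (x : B ⊗[ℂ] (⨂[ℂ]^n (RedAlg B))) -
  induction x using TensorProduct.induction_on with
  | zero => exact Submodule.zero_mem _
  | add x y hx hy => exact Submodule.add_mem _ hx hy
  | tmul b₀ t =>
    induction t using PiTensorProduct.induction_on with
    | smul_tprod r t =>
      choose b hb using fun i => Submodule.mkQ_surjective (Submodule.span ℂ {(1 : B)}) (t i)
      rw [TensorProduct.tmul_smul]
      refine Submodule.smul_mem _ _ (Submodule.subset_span ⟨b₀, b, ?_⟩)
      simp only [uform, hb]
      rfl
    | add x y hx hy =>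
      rw [TensorProduct.tmul_add]
      exact Submodule.add_mem _ hx hy

@[elab_as_elim]
theorem UForm.induction_on {n : ℕ} {p : UForm B n → Prop} (ω : UForm B n)
    (uform : ∀ b₀ b, p (uform b₀ b)) (zero : p 0) (add : ∀ x y, p x → p y → p (x + y))
    (smul : ∀ (c : ℂ) x, p x → p (c • x)) : p ω := by
  have hω : ω ∈ Submodule.span ℂ {ω : UForm B n | ∃ b₀ b, ω = QDS.uform b₀ b} := by
    rw [span_uform]; trivial
  induction hω using Submodule.span_induction with
  | mem x h => obtain ⟨b₀, b, rfl⟩ := h; exact uform b₀ b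
  | zero => exact zero
  | add x y _ _ hx hy => exact add x y hx hy
  | smul c x _ hx => exact smul c x hx

theorem UForm.hom_ext {n : ℕ} {E : Type*} [AddCommGroup E] [Module ℂ E] {f g : UForm B n →ₗ[ℂ] E}
    (h : ∀ b₀ b, f (uform b₀ b) = g (uform b₀ b)) : f = g := by
  ext ω
  induction ω using UForm.induction_on with
  | uform b₀ b => exact h b₀ b
  | zero => simp
  | add x y hx hy => simp [hx, hy]
  | smul c x hx => simp [hx]

/-- The map `b₀ db₁ ⋯ dbₙ ↦ θ₀(b₀) dθ(b₁) ⋯ dθ(bₙ)`. -/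
def uformMap (θ₀ θ : B →ₗ[ℂ] B') (h : θ 1 ∈ Submodule.span ℂ {(1 : B')}) (n : ℕ) :
    UForm B n →ₗ[ℂ] UForm B' n :=
  (TensorProduct.map θ₀ (PiTensorProduct.map fun _ =>
    Submodule.mapQ (Submodule.span ℂ {(1 : B)}) (Submodule.span ℂ {(1 : B')}) θ (by
      rw [Submodule.span_le, Set.singleton_subset_iff]; exact h)) :
    B ⊗[ℂ] (⨂[ℂ]^n (RedAlg B)) →ₗ[ℂ] B' ⊗[ℂ] (⨂[ℂ]^n (RedAlg B')))

theorem uformMap_uform (θ₀ θ : B →ₗ[ℂ] B') (h : θ 1 ∈ Submodule.span ℂ {(1 : B')}) {n : ℕ}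
    (b₀ : B) (b : Fin n → B) :
    uformMap θ₀ θ h n (uform b₀ b) = uform (θ₀ b₀) (fun i => θ (b i)) := by
  change TensorProduct.map _ _ (_ ⊗ₜ[ℂ] _) = _
  rw [TensorProduct.map_tmul, PiTensorProduct.map_tprod]
  rfl

end Functoriality

/-! ### The calculus of a subalgebra and that of the ambient algebra -/

namespace DiracData

variable {B H : Type*} [Ring B] [Algebra ℂ B] [NormedAddCommGroup H] [InnerProductSpace ℂ H]
  (X : DiracData B H) (S : NonUnitalSubalgebra ℂ B)

theorem comm_eq {b : B} {C : H →L[ℂ] H} (h : IsCommutator X.D (X.rep b) C) : X.comm b = C :=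
  (X.isCommutator_comm b).unique X.dense h

theorem comm_mul (a b : B) : X.comm (a * b) = X.comm a * X.rep b + X.rep a * X.comm b :=
  X.comm_eq (by rw [map_mul]; exact (X.isCommutator_comm a).mul (X.isCommutator_comm b))

theorem comm_add (a b : B) : X.comm (a + b) = X.comm a + X.comm b := X.commLin.map_add a b

theorem comm_sub (a b : B) : X.comm (a - b) = X.comm a - X.comm b := X.commLin.map_sub a b

theorem comm_smul (c : ℂ) (b : B) : X.comm (c • b) = c • X.comm b := X.commLin.map_smul c b

theorem comm_one : X.comm 1 = 0 := X.comm_eq (by simpa using IsCommutator.one X.D)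

/-- The inclusion of the minimal unitization of `S` into `B`. -/
abbrev unitizationHom : Unitization ℂ S →ₐ[ℂ] B :=
  Unitization.lift (NonUnitalSubalgebraClass.subtype S)

theorem unitizationHom_inr (s : S) : unitizationHom S (Unitization.inr s) = s := by
  simp [unitizationHom]

theorem unitization_rep (b : Unitization ℂ S) :
    (X.unitization S).rep b = X.rep (unitizationHom S b) := rfl

theorem unitization_comm (b : Unitization ℂ S) :
    (X.unitization S).comm b = X.comm (unitizationHom S b) :=
  (X.unitization S).comm_eq (X.isCommutator_comm (unitizationHom S b))

/-- The map of universal forms induced by the inclusion of the minimal unitization. -/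
def unitizationForm (n : ℕ) : UForm (Unitization ℂ S) n →ₗ[ℂ] UForm B n :=
  uformMap (unitizationHom S).toLinearMap (unitizationHom S).toLinearMap
    (by simp [Submodule.mem_span_singleton_self]) n

theorem unitizationForm_uform {n : ℕ} (b₀ : Unitization ℂ S) (b : Fin n → Unitization ℂ S) :
    unitizationForm S n (uform b₀ b)
      = uform (unitizationHom S b₀) (fun i => unitizationHom S (b i)) :=
  uformMap_uform _ _ _ _ _

theorem piOp_unitizationForm {n : ℕ} (ω : UForm (Unitization ℂ S) n) :
    X.piOp n (unitizationForm S n ω) = (X.unitization S).piOp n ω := by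
  refine LinearMap.congr_fun (f := (X.piOp n).comp (unitizationForm S n)) ?_ ω
  refine UForm.hom_ext fun b₀ b => ?_
  rw [LinearMap.comp_apply, unitizationForm_uform, piOp_uform, piOp_uform]
  simp only [unitization_comm, unitization_rep]

theorem udiff_unitizationForm {n : ℕ} (ω : UForm (Unitization ℂ S) n) :
    udiff B n (unitizationForm S n ω) = unitizationForm S (n + 1) (udiff _ n ω) := by
  refine LinearMap.congr_fun (f := (udiff B n).comp (unitizationForm S n))
    (g := (unitizationForm S (n + 1)).comp (udiff _ n)) ?_ ω
  refine UForm.hom_ext fun b₀ b => ?_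
  simp only [LinearMap.comp_apply, unitizationForm_uform, udiff_uform, map_one]
  congr 1
  funext i
  refine Fin.cases ?_ (fun i => ?_) i <;> simp

theorem mem_J₀_iff {n : ℕ} {ω : UForm B n} :
    ω ∈ X.J₀ n ↔ X.piOp n ω ∈ compactOperator (RingHom.id ℂ) H H := by
  rw [J₀, LinearMap.mem_ker, pi, LinearMap.comp_apply, toCalkin, Submodule.mkQ_apply,
    Submodule.Quotient.mk_eq_zero]

theorem J₀_le_J (n : ℕ) : X.J₀ n ≤ X.J n := by
  cases n with
  | zero => exact le_rfl
  | succ n => exact le_sup_left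

theorem mem_J_succ {n : ℕ} {ω : UForm B (n + 1)} :
    ω ∈ X.J (n + 1) ↔ ∃ η ∈ X.J₀ n, ω - udiff B n η ∈ X.J₀ (n + 1) := by
  rw [J, Submodule.mem_sup]
  constructor
  · rintro ⟨y, hy, _, ⟨η, hη, rfl⟩, rfl⟩
    exact ⟨η, hη, by simpa using hy⟩
  · rintro ⟨η, hη, h⟩
    exact ⟨_, h, _, ⟨η, hη, rfl⟩, by simp⟩

theorem unitizationForm_mem_J₀ {n : ℕ} {ω : UForm (Unitization ℂ S) n} :
    unitizationForm S n ω ∈ X.J₀ n ↔ ω ∈ (X.unitization S).J₀ n := by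
  rw [mem_J₀_iff, mem_J₀_iff, piOp_unitizationForm]

/-- Only this direction is formal. For the converse, the correcting form `η` on `B` has to be
replaced by one on the unitization of `S`; see `IsLocallyUnital.mem_J_of_unitizationForm_mem_J`. -/
theorem unitizationForm_mem_J {n : ℕ} {ω : UForm (Unitization ℂ S) n}
    (h : ω ∈ (X.unitization S).J n) : unitizationForm S n ω ∈ X.J n := by
  cases n with
  | zero => exact (X.unitizationForm_mem_J₀ S).2 h
  | succ n =>
    rw [mem_J_succ] at h ⊢
    obtain ⟨η, hη, h⟩ := h
    refine ⟨unitizationForm S n η, (X.unitizationForm_mem_J₀ S).2 hη, ?_⟩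
    rw [udiff_unitizationForm, ← map_sub]
    exact (X.unitizationForm_mem_J₀ S).2 h

/-- The canonical map from the calculus of the subalgebra `S` to that of `B`. -/
def nuOmegaMap (n : ℕ) : X.NuOmega S n →ₗ[ℂ] X.Omega n :=
  Submodule.mapQ _ _ ((unitizationForm S n).comp (nuForm S n).subtype)
    fun _ hω => X.unitizationForm_mem_J S hω

theorem nuOmegaMap_mk {n : ℕ} (ω : nuForm S n) :
    X.nuOmegaMap S n ((((X.unitization S).J n).submoduleOf (nuForm S n)).mkQ ω)
      = (X.J n).mkQ (unitizationForm S n ω) := rfl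

theorem nuOmegaMap_nuOmegaMk {n : ℕ} (s₀ : S) (s : Fin n → S) :
    X.nuOmegaMap S n (X.nuOmegaMk S s₀ s) = X.omegaMk (s₀ : B) (fun i => (s i : B)) := by
  rw [nuOmegaMk, nuOmegaMap_mk, omegaMk, unitizationForm_uform]
  simp only [unitizationHom_inr]

/-! ### The operators of the forms on a nonunital subalgebra -/

/-- The span of the operators `s₀ [D, s₁] ⋯ [D, sₙ]` with all `sᵢ` in `S`. -/
def nuOp : ℕ → Submodule ℂ (H →L[ℂ] H)
  | 0 => S.toSubmodule.map X.rep.toLinearMap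
  | n + 1 => nuOp n * S.toSubmodule.map X.commLin

variable {S}

theorem rep_mem_nuOp {s : B} (hs : s ∈ S) : X.rep s ∈ X.nuOp S 0 := ⟨s, hs, rfl⟩

theorem mul_comm_mem_nuOp_succ {n : ℕ} {y : H →L[ℂ] H} (hy : y ∈ X.nuOp S n) {s : B} (hs : s ∈ S) :
    y * X.comm s ∈ X.nuOp S (n + 1) :=
  Submodule.mul_mem_mul hy ⟨s, hs, rfl⟩

theorem nuOp_induction {p : ℕ → (H →L[ℂ] H) → Prop}
    (rep : ∀ s ∈ S, p 0 (X.rep s))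
    (mul_comm : ∀ n, ∀ y ∈ X.nuOp S n, ∀ s ∈ S, p n y → p (n + 1) (y * X.comm s))
    (add : ∀ n x y, p n x → p n y → p n (x + y))
    {n : ℕ} {y : H →L[ℂ] H} (hy : y ∈ X.nuOp S n) : p n y := by
  induction n generalizing y with
  | zero =>
    obtain ⟨s, hs, rfl⟩ := hy
    exact rep s hs
  | succ n ih =>
    rw [nuOp] at hy
    induction hy using Submodule.mul_induction_on' with
    | mem_mul_mem y hy c hc =>
      obtain ⟨s, hs, rfl⟩ := hc
      exact mul_comm n y hy s hs (ih hy)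
    | add x _ y _ hx hy => exact add _ _ _ hx hy

/-- Links the recursive description, suited to computing with operators, to the one that lifts an
operator back to a form on `S`. -/
theorem nuOp_eq_map (n : ℕ) :
    X.nuOp S n = (nuForm S n).map ((X.unitization S).piOp n) := by
  have hc : ∀ s : S, (X.unitization S).comm (Unitization.inr s) = X.comm s := fun s => by
    rw [unitization_comm, unitizationHom_inr]
  have hr : ∀ s : S, (X.unitization S).rep (Unitization.inr s) = X.rep s := fun s => by
    rw [unitization_rep, unitizationHom_inr]
  apply le_antisymm
  · intro y hy
    refine X.nuOp_induction (S := S)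
      (p := fun n y => y ∈ (nuForm S n).map ((X.unitization S).piOp n)) ?_ ?_ ?_ hy
    · intro s hs
      refine ⟨_, Submodule.subset_span ⟨⟨s, hs⟩, Fin.elim0, rfl⟩, ?_⟩
      rw [piOp_uform, hr]
      simp
    · intro n y hy' s hs hy
      clear hy'
      beta_reduce at hy ⊢
      rw [nuForm, Submodule.map_span] at hy
      induction hy using Submodule.span_induction with
      | mem y h =>
        obtain ⟨_, ⟨t₀, t, rfl⟩, rfl⟩ := h
        refine ⟨_, Submodule.subset_span ⟨t₀, Fin.snoc (α := fun _ => S) t ⟨s, hs⟩, rfl⟩, ?_⟩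
        rw [piOp_uform, piOp_uform, List.ofFn_succ']
        simp [hc, mul_assoc]
      | zero => simp
      | add x y _ _ hx hy => rw [add_mul]; exact Submodule.add_mem _ hx hy
      | smul c x _ hx => rw [smul_mul_assoc]; exact Submodule.smul_mem _ _ hx
    · exact fun n x y hx hy => Submodule.add_mem _ hx hy
  · rw [nuForm, Submodule.map_span, Submodule.span_le]
    rintro _ ⟨_, ⟨s₀, s, rfl⟩, rfl⟩
    rw [piOp_uform, hr]
    simp only [hc]
    induction n with
    | zero => simpa using X.rep_mem_nuOp s₀.2
    | succ n ih =>
      rw [List.ofFn_succ', List.concat_eq_append, List.prod_append, ← mul_assoc,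
        List.prod_singleton]
      exact X.mul_comm_mem_nuOp_succ (ih _) (s _).2

end DiracData

namespace DiracData

open Filter

variable {B H : Type*} [Ring B] [Algebra ℂ B] [NormedAddCommGroup H] [InnerProductSpace ℂ H]
  {X : DiracData B H} {S : NonUnitalSubalgebra ℂ B}

/-! ### Ideals with local units commuting with the Dirac operator -/

/-- `S` is a two-sided ideal of `B`, and `p` is a sequence of local units of `S` that commute with
the operator of `X`. -/
structure IsLocallyUnital (X : DiracData B H) (S : NonUnitalSubalgebra ℂ B) (p : ℕ → B) :
    Prop where
  mul_mem_left : ∀ b, ∀ s ∈ S, b * s ∈ S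
  mul_mem_right : ∀ b, ∀ s ∈ S, s * b ∈ S
  mem : ∀ m, p m ∈ S
  comm_eq_zero : ∀ m, X.comm (p m) = 0
  unit_mul : ∀ s ∈ S, ∀ᶠ m in atTop, p m * s = s
  mul_unit : ∀ s ∈ S, ∀ᶠ m in atTop, s * p m = s

namespace IsLocallyUnital

variable {p : ℕ → B} (hp : IsLocallyUnital X S p)

include hp

theorem comm_unit_mul (m : ℕ) (b : B) : X.comm (p m * b) = X.rep (p m) * X.comm b := by
  rw [comm_mul, hp.comm_eq_zero, zero_mul, zero_add]

theorem comm_mul_unit (m : ℕ) (b : B) : X.comm (b * p m) = X.comm b * X.rep (p m) := by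
  rw [comm_mul, hp.comm_eq_zero, mul_zero, add_zero]

/-- A local unit supplies the missing coefficient: `[D, s] = [D, pₘ s] = pₘ [D, s]`. -/
theorem comm_mem_nuOp {s : B} (hs : s ∈ S) : X.comm s ∈ X.nuOp S 1 := by
  obtain ⟨m, hm⟩ := (hp.unit_mul s hs).exists
  rw [← hm, hp.comm_unit_mul]
  exact X.mul_comm_mem_nuOp_succ (X.rep_mem_nuOp (hp.mem m)) hs

theorem rep_mul_mem_nuOp (b : B) {n : ℕ} {y : H →L[ℂ] H} (hy : y ∈ X.nuOp S n) :
    X.rep b * y ∈ X.nuOp S n := by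
  refine X.nuOp_induction (S := S) (p := fun n y => X.rep b * y ∈ X.nuOp S n) ?_ ?_ ?_ hy
  · intro s hs
    rw [← map_mul]
    exact X.rep_mem_nuOp (hp.mul_mem_left b s hs)
  · intro n y _ s hs h
    rw [← mul_assoc]
    exact X.mul_comm_mem_nuOp_succ h hs
  · intro n x y hx hy
    rw [mul_add]
    exact add_mem hx hy

theorem eventually_unit_mul {n : ℕ} {y : H →L[ℂ] H} (hy : y ∈ X.nuOp S n) :
    ∀ᶠ m in atTop, X.rep (p m) * y = y := by
  refine X.nuOp_induction (S := S) (p := fun n y => ∀ᶠ m in atTop, X.rep (p m) * y = y)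
    ?_ ?_ ?_ hy
  · intro s hs
    filter_upwards [hp.unit_mul s hs] with m hm
    rw [← map_mul, hm]
  · intro n y _ s hs h
    filter_upwards [h] with m hm
    rw [← mul_assoc, hm]
  · intro n x y hx hy
    filter_upwards [hx, hy] with m hx hy
    rw [mul_add, hx, hy]

theorem eventually_mul_unit {n : ℕ} {y : H →L[ℂ] H} (hy : y ∈ X.nuOp S n) :
    ∀ᶠ m in atTop, y * X.rep (p m) = y := by
  refine X.nuOp_induction (S := S) (p := fun n y => ∀ᶠ m in atTop, y * X.rep (p m) = y)
    ?_ ?_ ?_ hy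
  · intro s hs
    filter_upwards [hp.mul_unit s hs] with m hm
    rw [← map_mul, hm]
  · intro n y _ s hs h
    filter_upwards [hp.mul_unit s hs] with m hm
    rw [mul_assoc, ← hp.comm_mul_unit, hm]
  · intro n x y hx hy
    filter_upwards [hx, hy] with m hx hy
    rw [add_mul, hx, hy]

/-- Since `y = y pₘ` for some `m`, `b` may be replaced by `pₘ b`, which lies in the ideal. -/
theorem mul_comm_mem_nuOp {n : ℕ} {y : H →L[ℂ] H} (hy : y ∈ X.nuOp S n) (b : B) :
    y * X.comm b ∈ X.nuOp S (n + 1) := by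
  obtain ⟨m, hm⟩ := (hp.eventually_mul_unit hy).exists
  rw [← hm, mul_assoc, ← hp.comm_unit_mul]
  exact X.mul_comm_mem_nuOp_succ hy (hp.mul_mem_right b _ (hp.mem m))

theorem mul_rep_mem_nuOp {n : ℕ} {y : H →L[ℂ] H} (hy : y ∈ X.nuOp S n) :
    ∀ b, y * X.rep b ∈ X.nuOp S n := by
  refine X.nuOp_induction (S := S) (p := fun n y => ∀ b, y * X.rep b ∈ X.nuOp S n) ?_ ?_ ?_ hy
  · intro s hs b
    rw [← map_mul]
    exact X.rep_mem_nuOp (hp.mul_mem_right b s hs)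
  · intro n y hy s hs h b
    -- The Leibniz rule moves `b` past the last commutator; the extra term `(y s)[D, b]` is covered
    -- by the induction hypothesis and `mul_comm_mem_nuOp`.
    have h1 : X.comm s * X.rep b = X.comm (s * b) - X.rep s * X.comm b := by
      rw [comm_mul]; abel
    rw [mul_assoc, h1, mul_sub, ← mul_assoc]
    exact sub_mem (X.mul_comm_mem_nuOp_succ hy (hp.mul_mem_right b s hs))
      (hp.mul_comm_mem_nuOp (h s) b)
  · intro n x y hx hy b
    rw [add_mul]
    exact add_mem (hx b) (hy b)

theorem mul_mem_nuOp {x : H →L[ℂ] H} (hx : x ∈ X.nuOp S 1) {n : ℕ} {y : H →L[ℂ] H}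
    (hy : y ∈ X.nuOp S n) : x * y ∈ X.nuOp S (n + 1) := by
  refine X.nuOp_induction (S := S) (p := fun n y => x * y ∈ X.nuOp S (n + 1)) ?_ ?_ ?_ hy
  · intro s _
    exact hp.mul_rep_mem_nuOp hx s
  · intro n y _ s hs h
    rw [← mul_assoc]
    exact X.mul_comm_mem_nuOp_succ h hs
  · intro n x y hx hy
    rw [mul_add]
    exact add_mem hx hy

/-- Meant for `x = u`: it need not be the operator of a form on `S`, but it acts like one of degree
one on anything that a local unit fixes from the left. -/
theorem mul_mem_nuOp_of_mul_unit_mem {x : H →L[ℂ] H}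
    (hx : ∀ m, x * X.rep (p m) ∈ X.nuOp S 1) {n : ℕ} {y : H →L[ℂ] H}
    (hy : y ∈ X.nuOp S n) : x * y ∈ X.nuOp S (n + 1) := by
  obtain ⟨m, hm⟩ := (hp.eventually_unit_mul hy).exists
  rw [← hm, ← mul_assoc]
  exact hp.mul_mem_nuOp (hx m) hy

/-- The differential of a form on `S` is represented in `nuOp`. -/
theorem piOp_udiff_mem_nuOp {n : ℕ} {ω : UForm (Unitization ℂ S) n} (hω : ω ∈ nuForm S n) :
    (X.unitization S).piOp (n + 1) (udiff _ n ω) ∈ X.nuOp S (n + 1) := by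
  induction hω using Submodule.span_induction with
  | mem ω h =>
    obtain ⟨s₀, s, rfl⟩ := h
    have hc : ∀ t : S, (X.unitization S).comm (Unitization.inr t) = X.comm t := fun t => by
      rw [unitization_comm, unitizationHom_inr]
    rw [udiff_uform, piOp_uform, map_one, one_mul, List.ofFn_succ]
    simp only [Fin.cons_zero, Fin.cons_succ, hc]
    clear ω
    induction n with
    | zero => simpa using hp.comm_mem_nuOp s₀.2
    | succ n ih =>
      rw [List.ofFn_succ', List.concat_eq_append, ← List.cons_append, List.prod_append,
        List.prod_singleton]
      exact X.mul_comm_mem_nuOp_succ (ih fun i => s i.castSucc) (s _).2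
  | zero => simp
  | add x y _ _ hx hy => simpa using add_mem hx hy
  | smul c x _ hx => simpa using Submodule.smul_mem _ c hx

/-! ### Injectivity of the canonical map -/

theorem eventually_unit_mul_mul_unit (m : ℕ) (b : B) :
    ∀ᶠ k in atTop, p m * b * p k = p m * b :=
  hp.mul_unit _ (hp.mul_mem_right b _ (hp.mem m))

/-- Behind `pₘ T`, replacing each `b` by `pₖ b pₖ` goes unnoticed for large `k`. The second claim
drives the induction: partial products cut off on the left by any `pⱼ` are fixed on the right by all
late `pₖ`. The operator `T` will be `b₀` for a form and `[D, b₀]` for its differential. -/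
theorem eventually_truncate {T : H →L[ℂ] H}
    (hT : ∀ m, ∀ᶠ k in atTop, X.rep (p m) * T * X.rep (p k) = X.rep (p m) * T)
    (m : ℕ) (l : List B) :
    (∀ᶠ k in atTop, X.rep (p m) * T * X.rep (p k) *
        (l.map fun b => X.comm (p k * b * p k)).prod = X.rep (p m) * T * (l.map X.comm).prod) ∧
      ∀ j, ∀ᶠ k in atTop, X.rep (p j) * (T * (l.map X.comm).prod) * X.rep (p k)
        = X.rep (p j) * (T * (l.map X.comm).prod) := by
  induction l using List.reverseRecOn with
  | nil => exact ⟨by simpa only [List.map_nil, List.prod_nil, mul_one] using hT m,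
      by simpa only [List.map_nil, List.prod_nil, mul_one] using hT⟩
  | append_singleton l b ih =>
    have key : ∀ j, ∀ᶠ k in atTop, X.rep (p j) * (T * ((l ++ [b]).map X.comm).prod) * X.rep (p k)
        = X.rep (p j) * (T * ((l ++ [b]).map X.comm).prod) := by
      intro j
      -- Insert `pᵢ` before the last commutator; then `pᵢ [D, b] pₖ = [D, pᵢ b pₖ]`, and `pᵢ b` lies
      -- in the ideal, so `pₖ` is absorbed.
      obtain ⟨i, hi⟩ := (ih.2 j).exists
      filter_upwards [hp.eventually_unit_mul_mul_unit i b] with k hk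
      simp only [List.map_append, List.map_singleton, List.prod_append, List.prod_singleton]
      have h1 : X.rep (p i) * X.comm b * X.rep (p k) = X.rep (p i) * X.comm b := by
        rw [← hp.comm_unit_mul, ← hp.comm_mul_unit, hk]
      calc _ = (X.rep (p j) * (T * (l.map X.comm).prod)) * X.comm b * X.rep (p k) := by
            simp only [mul_assoc]
        _ = _ := by
            rw [← hi, mul_assoc, mul_assoc, ← mul_assoc (X.rep (p i)), h1]
            simp only [← mul_assoc]
            simp only [← mul_assoc] at hi
            rw [hi]
    refine ⟨?_, key⟩
    filter_upwards [ih.1, ih.2 m, key m] with k h1 h2 h3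
    simp only [List.map_append, List.map_singleton, List.prod_append, List.prod_singleton] at h3 ⊢
    -- The new factor is `pₖ [D, b] pₖ`; `h2` absorbs the left `pₖ` and `h3` the right one.
    rw [← mul_assoc, h1, hp.comm_mul_unit, hp.comm_unit_mul]
    simp only [← mul_assoc] at h2 h3 ⊢
    rw [h2, h3]

/-- The linear map `b ↦ q b r`, with values in the minimal unitization of `S`. -/
def compression (q r : S) : B →ₗ[ℂ] Unitization ℂ S where
  toFun b := Unitization.inr ⟨q * b * r, hp.mul_mem_left _ _ r.2⟩
  map_add' a b := by
    rw [← Unitization.inr_add]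
    exact congrArg _ (Subtype.ext (by simp [mul_add, add_mul]))
  map_smul' c b := by
    rw [RingHom.id_apply, ← Unitization.inr_smul]
    exact congrArg _ (Subtype.ext (by simp))

theorem unitizationHom_compression (q r : S) (b : B) :
    unitizationHom S (hp.compression q r b) = q * b * r :=
  unitizationHom_inr S _

/-- The linear map `b ↦ q b q + φ(b) (1 - q²)`, which is unital if `φ(1) = 1`. -/
def truncation (φ : B →ₗ[ℂ] ℂ) (q : S) : B →ₗ[ℂ] Unitization ℂ S :=
  hp.compression q q + φ.smulRight (1 - Unitization.inr (q * q))

/-- This is the purpose of the term with `φ`: plain compression does not preserve the unit, so it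
would not descend to the quotients by the scalars. -/
theorem truncation_one {φ : B →ₗ[ℂ] ℂ} (hφ : φ 1 = 1) (q : S) : hp.truncation φ q 1 = 1 := by
  have : hp.compression q q 1 = Unitization.inr (q * q) :=
    congrArg Unitization.inr (Subtype.ext (by simp))
  simp [truncation, this, hφ]

/-- The correction `φ(b)(1 - pₘ²)` is invisible to `D`, because `pₘ` commutes with it. -/
theorem comm_truncation (φ : B →ₗ[ℂ] ℂ) (m : ℕ) (b : B) :
    X.comm (unitizationHom S (hp.truncation φ ⟨p m, hp.mem m⟩ b)) = X.comm (p m * b * p m) := by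
  have h1 : X.comm (p m * p m) = 0 := by
    rw [hp.comm_unit_mul, hp.comm_eq_zero, mul_zero]
  rw [truncation, LinearMap.add_apply, map_add, comm_add, unitizationHom_compression,
    LinearMap.smulRight_apply, map_smul, comm_smul, map_sub, comm_sub, map_one, comm_one,
    unitizationHom_inr]
  simp [h1]

/-- The truncation of the universal forms of `B` to those of the unitization of `S`. -/
def truncateForm {φ : B →ₗ[ℂ] ℂ} (hφ : φ 1 = 1) (m k n : ℕ) :
    UForm B n →ₗ[ℂ] UForm (Unitization ℂ S) n :=
  -- The coefficient slot needs no unitality, so it is only compressed. Its left factor has the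
  -- fixed index `m`, which produces the prefactor `pₘ` in the operator.
  uformMap (hp.compression ⟨p m, hp.mem m⟩ ⟨p k, hp.mem k⟩)
    (hp.truncation φ ⟨p k, hp.mem k⟩)
    (by rw [hp.truncation_one hφ]; exact Submodule.mem_span_singleton_self 1) n

/-- One `k` must serve `η` and `dη` together, since the truncated form has to lie in `J₀` and have
the right differential. For `dη` the first factor is `[D, pₘ b₀ pₖ] = pₘ [D, b₀] pₖ`. -/
theorem piOp_truncateForm {φ : B →ₗ[ℂ] ℂ} (hφ : φ 1 = 1) (m : ℕ) {n : ℕ} (η : UForm B n) :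
    ∀ᶠ k in atTop,
      (X.unitization S).piOp n (hp.truncateForm hφ m k n η) = X.rep (p m) * X.piOp n η ∧
      (X.unitization S).piOp (n + 1) (udiff _ n (hp.truncateForm hφ m k n η))
        = X.rep (p m) * X.piOp (n + 1) (udiff _ n η) := by
  induction η using UForm.induction_on with
  | uform b₀ b =>
    have h0 : ∀ j, ∀ᶠ k in atTop, X.rep (p j) * X.rep b₀ * X.rep (p k)
        = X.rep (p j) * X.rep b₀ := fun j => by
      filter_upwards [hp.eventually_unit_mul_mul_unit j b₀] with k hk
      rw [← map_mul, ← map_mul, hk]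
    have h1 : ∀ j, ∀ᶠ k in atTop, X.rep (p j) * X.comm b₀ * X.rep (p k)
        = X.rep (p j) * X.comm b₀ := fun j => by
      filter_upwards [hp.eventually_unit_mul_mul_unit j b₀] with k hk
      rw [← hp.comm_unit_mul, ← hp.comm_mul_unit, hk]
    filter_upwards [(hp.eventually_truncate h0 m (List.ofFn b)).1,
      (hp.eventually_truncate h1 m (List.ofFn b)).1] with k h2 h3
    rw [List.map_ofFn, List.map_ofFn] at h2 h3
    constructor
    · rw [truncateForm, uformMap_uform, piOp_uform, piOp_uform, ← mul_assoc]
      simp only [unitization_comm, unitization_rep, comm_truncation, unitizationHom_compression,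
        map_mul]
      exact h2
    · rw [truncateForm, uformMap_uform, udiff_uform, udiff_uform, piOp_uform, piOp_uform]
      simp only [map_one, one_mul, List.ofFn_succ, Fin.cons_zero, Fin.cons_succ, List.prod_cons]
      simp only [unitization_comm, comm_truncation, unitizationHom_compression]
      rw [hp.comm_mul_unit, hp.comm_unit_mul, ← mul_assoc]
      exact h3
  | zero => simp
  | add x y hx hy =>
    filter_upwards [hx, hy] with k hx hy
    simp only [map_add, mul_add, hx, hy, and_self]
  | smul c x hx =>
    filter_upwards [hx] with k hx
    simp only [map_smul, mul_smul_comm, hx, and_self]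

/-- Choose `m` so that `pₘ` fixes the operator of `ω`. Left multiplication by `pₘ` preserves
compactness, so the truncation of `η` witnesses membership over the unitization. -/
theorem mem_J_of_unitizationForm_mem_J [Nontrivial B] {n : ℕ}
    {ω : UForm (Unitization ℂ S) (n + 1)} (hω : ω ∈ nuForm S (n + 1))
    (h : unitizationForm S (n + 1) ω ∈ X.J (n + 1)) : ω ∈ (X.unitization S).J (n + 1) := by
  obtain ⟨φ, hφ⟩ := Module.Projective.exists_dual_eq_one ℂ (one_ne_zero (α := B))
  obtain ⟨η, hη, h⟩ := X.mem_J_succ.1 h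
  have hy : (X.unitization S).piOp (n + 1) ω ∈ X.nuOp S (n + 1) := by
    rw [nuOp_eq_map]; exact ⟨ω, hω, rfl⟩
  obtain ⟨m, hm⟩ := (hp.eventually_unit_mul hy).exists
  obtain ⟨k, h1, h2⟩ := (hp.piOp_truncateForm hφ m η).exists
  have hcomp : ∀ T ∈ compactOperator (RingHom.id ℂ) H H,
      X.rep (p m) * T ∈ compactOperator (RingHom.id ℂ) H H := fun T hT =>
    IsCompactOperator.clm_comp hT (X.rep (p m))
  refine (X.unitization S).mem_J_succ.2 ⟨hp.truncateForm hφ m k n η, ?_, ?_⟩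
  · rw [mem_J₀_iff, h1]
    exact hcomp _ ((X.mem_J₀_iff).1 hη)
  · rw [mem_J₀_iff, map_sub, h2, ← hm, ← mul_sub, ← piOp_unitizationForm, ← map_sub]
    exact hcomp _ ((X.mem_J₀_iff).1 h)

theorem nuOmegaMap_injective [Nontrivial B] (n : ℕ) :
    Function.Injective (X.nuOmegaMap S (n + 1)) := by
  rw [injective_iff_map_eq_zero]
  intro x hx
  obtain ⟨ω, rfl⟩ := Submodule.mkQ_surjective _ x
  rw [nuOmegaMap_mk, Submodule.mkQ_apply, Submodule.Quotient.mk_eq_zero] at hx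
  rw [Submodule.mkQ_apply, Submodule.Quotient.mk_eq_zero]
  exact hp.mem_J_of_unitizationForm_mem_J ω.2 hx

end IsLocallyUnital

end DiracData

/-! ### Extensions of the Laurent polynomials and their symbols -/

open LaurentPolynomial in
/-- The derivation `-z d/dz` of the Laurent polynomials. -/
def eulerDeriv : ℂ[T;T⁻¹] →ₗ[ℂ] ℂ[T;T⁻¹] :=
  (Finsupp.lsum ℂ fun n : ℤ => LinearMap.toSpanSingleton ℂ _ (-(n : ℂ) • (T n : ℂ[T;T⁻¹]))).comp
    (AddMonoidAlgebra.coeffLinearEquiv ℂ).toLinearMap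

open LaurentPolynomial in
-- The sign reflects `[N, lⁿ] = -n lⁿ` for the left shift.
theorem eulerDeriv_T (n : ℤ) : eulerDeriv (T n) = -(n : ℂ) • T n := by
  have : (AddMonoidAlgebra.coeffLinearEquiv ℂ) (T n : ℂ[T;T⁻¹]) = Finsupp.single n (1 : ℂ) := rfl
  rw [eulerDeriv, LinearMap.comp_apply, LinearEquiv.coe_coe, this, Finsupp.lsum_single]
  simp

namespace DiracData

open Filter LaurentPolynomial

variable {B H : Type*} [Ring B] [Algebra ℂ B] [NormedAddCommGroup H] [InnerProductSpace ℂ H]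
  {X : DiracData B H} {S : NonUnitalSubalgebra ℂ B}

theorem exists_eq_uform_zero (η : UForm B 0) : ∃ b, η = uform b Fin.elim0 := by
  induction η using UForm.induction_on with
  | uform b₀ b => exact ⟨b₀, by rw [Subsingleton.elim b]⟩
  | zero => exact ⟨0, (TensorProduct.zero_tmul _ _).symm⟩
  | add x y hx hy =>
    obtain ⟨a, rfl⟩ := hx
    obtain ⟨b, rfl⟩ := hy
    exact ⟨a + b, (TensorProduct.add_tmul _ _ _).symm⟩
  | smul c x hx =>
    obtain ⟨a, rfl⟩ := hx
    exact ⟨c • a, TensorProduct.smul_tmul' _ _ _⟩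

/-- `B` is an extension of the Laurent polynomials by the ideal `S`, with linear splitting `σ`, and
`[D, σ(f)] = u σ(-z f')`. -/
structure IsLaurentExtension (X : DiracData B H) (S : NonUnitalSubalgebra ℂ B) (p : ℕ → B)
    (σ : ℂ[T;T⁻¹] →ₗ[ℂ] B) (u : H →L[ℂ] H) : Prop extends IsLocallyUnital X S p where
  one_eq : σ 1 = 1
  mul_sub_mem : ∀ f g, σ f * σ g - σ (f * g) ∈ S
  exists_symbol : ∀ b, ∃ f, b - σ f ∈ S
  comm_symbol : ∀ f, X.comm (σ f) = u * X.rep (σ (eulerDeriv f))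
  commute : ∀ f, Commute u (X.rep (σ f))
  mul_unit_mem : ∀ m, u * X.rep (p m) ∈ X.nuOp S 1

/-- No nonzero symbol is represented by a compact operator modulo the forms on the ideal. -/
def SymbolInjective (X : DiracData B H) (S : NonUnitalSubalgebra ℂ B) (σ : ℂ[T;T⁻¹] →ₗ[ℂ] B)
    (u : H →L[ℂ] H) : Prop :=
  ∀ n f, ∀ y ∈ X.nuOp S n,
    u ^ n * X.rep (σ f) - y ∈ compactOperator (RingHom.id ℂ) H H → f = 0

namespace IsLaurentExtension

variable {p : ℕ → B} {σ : ℂ[T;T⁻¹] →ₗ[ℂ] B} {u : H →L[ℂ] H}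
  (hσ : IsLaurentExtension X S p σ u)

include hσ

theorem pow_mul_mem_nuOp (n : ℕ) {k : ℕ} {y : H →L[ℂ] H} (hy : y ∈ X.nuOp S k) :
    u ^ n * y ∈ X.nuOp S (k + n) := by
  induction n with
  | zero => simpa using hy
  | succ n ih =>
    rw [pow_succ', mul_assoc]
    exact hσ.mul_mem_nuOp_of_mul_unit_mem hσ.mul_unit_mem ih

/-- Three replacements, each with an error in `nuOp`: `t` by `u^n σ(f)`, then `b` by `σ(g)`, then
the product of two values of `σ` by the value at the product. The commutation of `u` with symbols
collects the powers of `u` in front. -/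
theorem mul_comm_sub_mem_nuOp {n : ℕ} {t : H →L[ℂ] H} {f g : ℂ[T;T⁻¹]} {b : B}
    (ht : t - u ^ n * X.rep (σ f) ∈ X.nuOp S n) (hb : b - σ g ∈ S) :
    t * X.comm b - u ^ (n + 1) * X.rep (σ (f * eulerDeriv g)) ∈ X.nuOp S (n + 1) := by
  have h1 := hσ.mul_comm_mem_nuOp ht b
  have h2 : u ^ n * (X.rep (σ f) * X.comm (b - σ g)) ∈ X.nuOp S (1 + n) :=
    hσ.pow_mul_mem_nuOp n (hσ.rep_mul_mem_nuOp _ (hσ.comm_mem_nuOp hb))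
  have h3 : u ^ (n + 1) * X.rep (σ f * σ (eulerDeriv g) - σ (f * eulerDeriv g))
      ∈ X.nuOp S (0 + (n + 1)) :=
    hσ.pow_mul_mem_nuOp (n + 1) (X.rep_mem_nuOp (hσ.mul_sub_mem _ _))
  rw [add_comm 1 n] at h2
  rw [zero_add] at h3
  convert add_mem (add_mem h1 h2) h3 using 1
  have h4 : X.rep (σ f) * (u * X.rep (σ (eulerDeriv g)))
      = u * (X.rep (σ f) * X.rep (σ (eulerDeriv g))) := by
    rw [← mul_assoc, ← (hσ.commute f).eq, mul_assoc]
  rw [comm_sub, hσ.comm_symbol, _root_.map_sub X.rep,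
    map_mul X.rep, mul_sub (X.rep (σ f)), h4, pow_succ]
  simp only [sub_mul, mul_sub, mul_assoc]
  abel

/-- The operator of `b₀ db₁ ⋯ dbₙ` is determined by the symbols up to the operators of the forms on
the ideal. -/
theorem piOp_uform_sub_mem_nuOp {n : ℕ} {b₀ : B} {b : Fin n → B} {f : ℂ[T;T⁻¹]}
    {g : Fin n → ℂ[T;T⁻¹]} (h₀ : b₀ - σ f ∈ S) (h : ∀ i, b i - σ (g i) ∈ S) :
    X.piOp n (uform b₀ b) - u ^ n * X.rep (σ (f * ∏ i, eulerDeriv (g i))) ∈ X.nuOp S n := by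
  induction n with
  | zero =>
    rw [piOp_uform]
    simpa using X.rep_mem_nuOp h₀
  | succ n ih =>
    have := hσ.mul_comm_sub_mem_nuOp (ih fun i => h i.castSucc) (h (Fin.last n))
    rw [piOp_uform] at this ⊢
    rwa [List.ofFn_succ', List.concat_eq_append, List.prod_append, List.prod_singleton,
      ← mul_assoc, Fin.prod_univ_castSucc, ← mul_assoc f]

theorem exists_piOp_sub_mem_nuOp {n : ℕ} (ω : UForm B n) :
    ∃ f, X.piOp n ω - u ^ n * X.rep (σ f) ∈ X.nuOp S n := by
  induction ω using UForm.induction_on with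
  | uform b₀ b =>
    obtain ⟨f, hf⟩ := hσ.exists_symbol b₀
    choose g hg using fun i => hσ.exists_symbol (b i)
    exact ⟨_, hσ.piOp_uform_sub_mem_nuOp hf hg⟩
  | zero => exact ⟨0, by simp⟩
  | add x y hx hy =>
    obtain ⟨f, hf⟩ := hx
    obtain ⟨g, hg⟩ := hy
    refine ⟨f + g, ?_⟩
    convert add_mem hf hg using 1
    simp only [map_add, mul_add]
    abel
  | smul c x hx =>
    obtain ⟨f, hf⟩ := hx
    refine ⟨c • f, ?_⟩
    convert Submodule.smul_mem _ c hf using 1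
    simp only [map_smul, mul_smul_comm, smul_sub]

/-! ### Surjectivity of the canonical map in degrees `≥ 2` -/

/-- The form `2 z^{m+1} dz (dz)^n - z^m d(z²) (dz)^n` has symbol zero, so subtracting a form on the
ideal puts it in `J₀`. Its differential has symbol a multiple of `z^k` with factor `±(2(m + 1) - 2m)
= ±2`, which does not vanish. -/
theorem exists_udiff_symbol (n : ℕ) (k : ℤ) :
    ∃ η ∈ X.J₀ (n + 1), X.piOp (n + 2) (udiff B (n + 1) η)
      - u ^ (n + 2) * X.rep (σ (T k)) ∈ X.nuOp S (n + 2) := by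
  have hS : ∀ f, σ f - σ f ∈ S := fun f => by rw [sub_self]; exact S.zero_mem
  have hTn : ∀ j : ℕ, (-T 1 : ℂ[T;T⁻¹]) ^ j = (-1) ^ j * T (j : ℤ) := fun j => by
    rw [neg_pow, T_pow, mul_one]
  -- With this exponent all four symbols below are multiples of `z^k`, as `(m + 1) + (n + 1) = k`.
  set m : ℤ := k - n - 2 with hm
  have hd1 : eulerDeriv (T 1) = -T 1 := by rw [eulerDeriv_T]; simp
  -- the forms `z^{m+1} dz (dz)^n` and `z^m d(z²) (dz)^n`
  set η₁ : UForm B (n + 1) := uform (σ (T (m + 1))) fun _ => σ (T 1) with hη₁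
  set η₂ : UForm B (n + 1) :=
    uform (σ (T m)) (Fin.cons (σ (T 2)) fun _ => σ (T 1)) with hη₂
  have e1 := hσ.piOp_uform_sub_mem_nuOp (hS (T (m + 1))) (g := fun _ : Fin (n + 1) => T 1)
    (b := fun _ => σ (T 1)) (fun _ => hS _)
  have e2 := hσ.piOp_uform_sub_mem_nuOp (hS (T m))
    (g := (Fin.cons (T 2) fun _ => T 1 : Fin (n + 1) → ℂ[T;T⁻¹]))
    (b := Fin.cons (σ (T 2)) fun _ => σ (T 1)) (fun i => by
      refine Fin.cases ?_ (fun i => ?_) i <;> simp)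
  have e3 := hσ.piOp_uform_sub_mem_nuOp (b₀ := 1) (f := 1)
    (by rw [hσ.one_eq, sub_self]; exact S.zero_mem)
    (g := (Fin.cons (T (m + 1)) fun _ => T 1 : Fin (n + 2) → ℂ[T;T⁻¹]))
    (b := Fin.cons (σ (T (m + 1))) fun _ => σ (T 1)) (fun i => by
      refine Fin.cases ?_ (fun i => ?_) i <;> simp)
  have e4 := hσ.piOp_uform_sub_mem_nuOp (b₀ := 1) (f := 1)
    (by rw [hσ.one_eq, sub_self]; exact S.zero_mem)
    (g := (Fin.cons (T m) (Fin.cons (T 2) fun _ => T 1) : Fin (n + 2) → ℂ[T;T⁻¹]))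
    (b := Fin.cons (σ (T m)) (Fin.cons (σ (T 2)) fun _ => σ (T 1))) (fun i => by
      refine Fin.cases ?_ (fun i => Fin.cases ?_ (fun i => ?_) i) i <;> simp)
  have c1 : T (m + 1) * ∏ _i : Fin (n + 1), eulerDeriv (T 1) = (-(-1) ^ n : ℂ) • T k := by
    rw [Finset.prod_const, Finset.card_univ, Fintype.card_fin, hd1, hTn, mul_left_comm, ← T_add,
      show m + 1 + (n + 1 : ℕ) = k by rw [hm]; push_cast; ring]
    simp [Algebra.smul_def, pow_succ]
  have c2 : T m * ∏ i : Fin (n + 1), eulerDeriv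
      ((Fin.cons (T 2) fun _ => T 1 : Fin (n + 1) → ℂ[T;T⁻¹]) i) = (-2 * (-1) ^ n : ℂ) • T k := by
    simp only [Fin.prod_univ_succ, Fin.cons_zero, Fin.cons_succ, Finset.prod_const,
      Finset.card_univ, Fintype.card_fin]
    rw [hd1, hTn, eulerDeriv_T, show k = m + 2 + (n : ℕ) by rw [hm]; ring,
      T_add, T_add]
    simp only [Algebra.smul_def, map_mul, map_neg, map_pow, map_one, map_ofNat, Int.cast_ofNat]
    ring
  have c3 : 1 * ∏ i : Fin (n + 2), eulerDeriv
      ((Fin.cons (T (m + 1)) fun _ => T 1 : Fin (n + 2) → ℂ[T;T⁻¹]) i)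
      = ((m + 1) * (-1) ^ n : ℂ) • T k := by
    rw [Fin.prod_univ_succ]
    simp only [Fin.cons_zero, Fin.cons_succ, Finset.prod_const,
      Finset.card_univ, Fintype.card_fin]
    rw [hd1, hTn, eulerDeriv_T, show k = m + 1 + (n + 1 : ℕ) by rw [hm]; push_cast; ring,
      T_add _ ((n + 1 : ℕ) : ℤ)]
    simp only [Algebra.smul_def, map_mul, map_neg, map_pow, map_one, map_add, Int.cast_add,
      Int.cast_one]
    ring
  have c4 : 1 * ∏ i : Fin (n + 2), eulerDeriv
      ((Fin.cons (T m) (Fin.cons (T 2) fun _ => T 1) : Fin (n + 2) → ℂ[T;T⁻¹]) i)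
      = (2 * m * (-1) ^ n : ℂ) • T k := by
    rw [Fin.prod_univ_succ, Fin.prod_univ_succ]
    simp only [Fin.cons_zero, Fin.cons_succ, Finset.prod_const,
      Finset.card_univ, Fintype.card_fin]
    rw [hd1, hTn, eulerDeriv_T, eulerDeriv_T, show k = m + 2 + (n : ℕ) by rw [hm]; ring,
      T_add, T_add]
    simp only [Algebra.smul_def, map_mul, map_neg, map_pow, map_one, map_ofNat, Int.cast_ofNat]
    ring
  rw [c1, map_smul, map_smul, mul_smul_comm] at e1
  rw [c2, map_smul, map_smul, mul_smul_comm] at e2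
  rw [c3, map_smul, map_smul, mul_smul_comm] at e3
  rw [c4, map_smul, map_smul, mul_smul_comm] at e4
  rw [← udiff_uform] at e3 e4
  have h0 : X.piOp (n + 1) ((2 : ℂ) • η₁ - η₂) ∈ X.nuOp S (n + 1) := by
    convert sub_mem (Submodule.smul_mem _ (2 : ℂ) e1) e2 using 1
    rw [map_sub, map_smul]
    module
  rw [nuOp_eq_map] at h0
  obtain ⟨ω, hω, hω'⟩ := h0
  -- The scalar inverts `2 (-1)^n`, the coefficient of `z^k` in the symbol of the differential.
  refine ⟨((-1) ^ n / 2 : ℂ) • ((2 : ℂ) • η₁ - η₂ - unitizationForm S (n + 1) ω),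
    Submodule.smul_mem _ _ ?_, ?_⟩
  · rw [mem_J₀_iff, map_sub, piOp_unitizationForm, hω', sub_self]
    exact Submodule.zero_mem _
  · have h1 := hσ.piOp_udiff_mem_nuOp hω
    rw [← piOp_unitizationForm, ← udiff_unitizationForm] at h1
    convert Submodule.smul_mem _ ((-1) ^ n / 2 : ℂ)
      (sub_mem (sub_mem (Submodule.smul_mem _ (2 : ℂ) e3) e4) h1) using 1
    have h2 : ((-1) ^ n * (-1) ^ n : ℂ) = 1 := by rw [← mul_pow]; simp
    simp only [map_smul, map_sub, hη₁, hη₂, smul_sub, smul_smul]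
    generalize u ^ (n + 2) * X.rep (σ (T k)) = V
    have h3 : V = ((-1) ^ n / 2 * (2 * ((m + 1) * (-1) ^ n)) : ℂ) • V
        - ((-1) ^ n / 2 * (2 * m * (-1) ^ n) : ℂ) • V := by
      rw [← sub_smul]
      conv_lhs => rw [← one_smul ℂ V]
      congr 1
      linear_combination -h2
    nth_rewrite 1 [h3]
    abel

theorem pow_mul_symbol_mem (n : ℕ) (f : ℂ[T;T⁻¹]) :
    ∃ η ∈ X.J₀ (n + 1), X.piOp (n + 2) (udiff B (n + 1) η) - u ^ (n + 2) * X.rep (σ f)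
      ∈ X.nuOp S (n + 2) := by
  induction f using LaurentPolynomial.induction_on' with
  | add f g hf hg =>
    obtain ⟨η, hη, h⟩ := hf
    obtain ⟨η', hη', h'⟩ := hg
    refine ⟨η + η', add_mem hη hη', ?_⟩
    convert add_mem h h' using 1
    simp only [map_add, mul_add]
    abel
  | C_mul_T k c =>
    obtain ⟨η, hη, h⟩ := hσ.exists_udiff_symbol n k
    refine ⟨c • η, Submodule.smul_mem _ _ hη, ?_⟩
    convert Submodule.smul_mem _ c h using 1
    rw [← smul_eq_C_mul]
    simp only [map_smul, mul_smul_comm, smul_sub]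

/-- Subtracting a suitable `dη` with `η ∈ J₀` removes the symbol. What remains is the operator of a
form on the ideal, and forms with equal operators agree modulo `J₀`. -/
theorem nuOmegaMap_surjective (n : ℕ) : Function.Surjective (X.nuOmegaMap S (n + 2)) := by
  intro x
  obtain ⟨ω, rfl⟩ := Submodule.mkQ_surjective _ x
  obtain ⟨f, hf⟩ := hσ.exists_piOp_sub_mem_nuOp ω
  obtain ⟨η, hη, h⟩ := hσ.pow_mul_symbol_mem n f
  have h0 := sub_mem hf h
  rw [sub_sub_sub_cancel_right, nuOp_eq_map] at h0
  obtain ⟨ω', hω', h1⟩ := h0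
  refine ⟨Submodule.mkQ _ ⟨ω', hω'⟩, ?_⟩
  rw [nuOmegaMap_mk, ← sub_eq_zero, ← map_sub, Submodule.mkQ_apply, Submodule.Quotient.mk_eq_zero,
    ← neg_mem_iff, neg_sub, mem_J_succ]
  refine ⟨η, hη, ?_⟩
  rw [mem_J₀_iff, map_sub, map_sub, piOp_unitizationForm, h1, sub_sub, sub_add_cancel, sub_self]
  exact Submodule.zero_mem _

theorem exists_omega_equiv [Nontrivial B] {n : ℕ} (hn : 2 ≤ n) :
    ∃ Φ : X.Omega n ≃ₗ[ℂ] X.NuOmega S n, ∀ (s₀ : S) (s : Fin n → S),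
      Φ (X.omegaMk (s₀ : B) fun i => (s i : B)) = X.nuOmegaMk S s₀ s := by
  obtain ⟨k, rfl⟩ := Nat.exists_eq_add_of_le' hn
  have h : Function.Bijective (X.nuOmegaMap S (k + 2)) :=
    ⟨hσ.nuOmegaMap_injective (k + 1), hσ.nuOmegaMap_surjective k⟩
  refine ⟨(LinearEquiv.ofBijective _ h).symm, fun s₀ s => ?_⟩
  rw [← nuOmegaMap_nuOmegaMk, LinearEquiv.ofBijective_symm_apply_apply]

/-! ### Degree one -/

theorem exists_uform_piOp_eq (f : ℂ[T;T⁻¹]) : u * X.rep (σ f) ∈ LinearMap.range (X.piOp 1) := by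
  have hN : X.nuOp S 1 ≤ LinearMap.range (X.piOp 1) := by
    rw [nuOp_eq_map]
    rintro _ ⟨ω, -, rfl⟩
    exact ⟨_, X.piOp_unitizationForm S ω⟩
  have hS : ∀ f, σ f - σ f ∈ S := fun f => by rw [sub_self]; exact S.zero_mem
  have key : ∀ g h, u * X.rep (σ (g * eulerDeriv h)) ∈ LinearMap.range (X.piOp 1) := by
    intro g h
    have h1 := hσ.piOp_uform_sub_mem_nuOp (hS g) (b := fun _ : Fin 1 => σ h) fun _ => hS h
    rw [Fin.prod_univ_one, pow_one] at h1
    have h2 := sub_mem (LinearMap.mem_range_self (X.piOp 1) (uform (σ g) fun _ => σ h)) (hN h1)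
    rwa [sub_sub_cancel] at h2
  induction f using LaurentPolynomial.induction_on' with
  | add f g hf hg =>
    rw [map_add, map_add, mul_add]
    exact add_mem hf hg
  | C_mul_T k c =>
    rw [← smul_eq_C_mul, map_smul, map_smul, mul_smul_comm]
    refine Submodule.smul_mem _ _ ?_
    -- `z⁻¹` is fixed by `-z d/dz`, so `z^{k+1} d(z⁻¹)` has symbol exactly `z^k`.
    have h1 := key (T (k + 1)) (T (-1))
    rwa [eulerDeriv_T, Int.cast_neg, Int.cast_one, neg_neg, one_smul, ← T_add,
      add_neg_cancel_right] at h1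

/-- Here degree one differs from the higher degrees: the correcting `η` is a single element `b`
acting compactly. Symbol injectivity in degree zero puts `b` in the ideal, so `[D, b]` carries no
symbol, and injectivity in degree one applies to `ω - dη`. -/
theorem eq_zero_of_mem_J_one (hinj : SymbolInjective X S σ u) {ω : UForm B 1} (hω : ω ∈ X.J 1)
    {f : ℂ[T;T⁻¹]} (h : X.piOp 1 ω - u * X.rep (σ f) ∈ X.nuOp S 1) : f = 0 := by
  obtain ⟨η, hη, h'⟩ := X.mem_J_succ.1 hω
  rw [mem_J₀_iff] at hη h'
  rw [map_sub] at h'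
  obtain ⟨b, hb⟩ := exists_eq_uform_zero η
  obtain ⟨g, hg⟩ := hσ.exists_symbol b
  have hb0 : X.piOp 0 η = X.rep b := by rw [hb, piOp_uform]; simp
  have hg0 : g = 0 := by
    refine hinj 0 g (-X.rep (b - σ g)) (neg_mem (X.rep_mem_nuOp hg)) ?_
    rw [hb0] at hη
    simpa using hη
  rw [hg0, map_zero, sub_zero] at hg
  have hd : X.piOp 1 (udiff B 0 η) = X.comm b := by
    rw [hb, udiff_uform, piOp_uform]; simp
  refine hinj 1 f (X.comm b - (X.piOp 1 ω - u * X.rep (σ f)))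
    (sub_mem (hσ.comm_mem_nuOp hg) h) ?_
  rw [pow_one]
  convert h' using 1
  change _ = X.piOp 1 ω - X.piOp 1 (udiff B 0 η)
  rw [hd]
  abel

theorem exists_omega_one_equiv [Nontrivial B] (hinj : SymbolInjective X S σ u) :
    ∃ Φ : X.Omega 1 ≃ₗ[ℂ] X.NuOmega S 1 × ℂ[T;T⁻¹],
      (∀ x, Φ (X.nuOmegaMap S 1 x) = (x, 0)) ∧
      ∀ f, ∃ ω : UForm B 1, X.piOp 1 ω = u * X.rep (σ f) ∧ Φ ((X.J 1).mkQ ω) = (0, f) := by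
  let V : ℂ[T;T⁻¹] →ₗ[ℂ] LinearMap.range (X.piOp 1) :=
    ((LinearMap.mulLeft ℂ u).comp (X.rep.toLinearMap.comp σ)).codRestrict _
      hσ.exists_uform_piOp_eq
  -- Vector spaces are projective, so a form with operator `u σ(f)` can be chosen linearly in `f`.
  obtain ⟨κ, hκ⟩ := Module.projective_lifting_property (X.piOp 1).rangeRestrict V
    (X.piOp 1).surjective_rangeRestrict
  have hκ' : ∀ f, X.piOp 1 (κ f) = u * X.rep (σ f) := fun f =>
    congrArg Subtype.val (LinearMap.congr_fun hκ f)
  let Ψ : X.NuOmega S 1 × ℂ[T;T⁻¹] →ₗ[ℂ] X.Omega 1 :=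
    (X.nuOmegaMap S 1).coprod ((X.J 1).mkQ.comp κ)
  have hΨ' : ∀ x f, Ψ (x, f) = X.nuOmegaMap S 1 x + (X.J 1).mkQ (κ f) := fun _ _ => rfl
  have hΨ : Function.Bijective Ψ := by
    constructor
    · rw [injective_iff_map_eq_zero]
      rintro ⟨x, f⟩ h
      have h' : X.nuOmegaMap S 1 x + (X.J 1).mkQ (κ f) = 0 := h
      have hf : f = 0 := by
        obtain ⟨ω, rfl⟩ := Submodule.mkQ_surjective _ x
        rw [nuOmegaMap_mk, ← map_add, Submodule.mkQ_apply, Submodule.Quotient.mk_eq_zero] at h'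
        refine hσ.eq_zero_of_mem_J_one hinj h' ?_
        rw [map_add, hκ', add_sub_cancel_right, piOp_unitizationForm, nuOp_eq_map]
        exact ⟨ω, ω.2, rfl⟩
      rw [hf, map_zero, map_zero, add_zero] at h'
      rw [hf, hσ.nuOmegaMap_injective 0 (h'.trans (map_zero _).symm)]
      rfl
    · intro x
      obtain ⟨ω, rfl⟩ := Submodule.mkQ_surjective _ x
      obtain ⟨f, hf⟩ := hσ.exists_piOp_sub_mem_nuOp ω
      rw [nuOp_eq_map, pow_one] at hf
      obtain ⟨ω', hω', h1⟩ := hf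
      refine ⟨(Submodule.mkQ _ ⟨ω', hω'⟩, f), ?_⟩
      rw [hΨ', nuOmegaMap_mk, ← map_add, ← sub_eq_zero, ← map_sub, Submodule.mkQ_apply,
        Submodule.Quotient.mk_eq_zero]
      refine X.J₀_le_J 1 ?_
      rw [mem_J₀_iff, map_sub, map_add, hκ', piOp_unitizationForm, h1, sub_add_cancel, sub_self]
      exact Submodule.zero_mem _
  refine ⟨(LinearEquiv.ofBijective Ψ hΨ).symm, fun x => ?_, fun f => ⟨κ f, hκ' f, ?_⟩⟩
  · rw [LinearEquiv.symm_apply_eq, LinearEquiv.ofBijective_apply, hΨ', map_zero, map_zero, add_zero]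
  · rw [LinearEquiv.symm_apply_eq, LinearEquiv.ofBijective_apply, hΨ', map_zero, zero_add]

end IsLaurentExtension

end DiracData

open Filter LaurentPolynomial

/-! ### Shifts and finite matrices -/

section Shift

local notation "rshift" => ContinuousLinearMap.adjoint shift

theorem e_apply (n m : ℕ) : e n m = if m = n then 1 else 0 := by
  rw [e, lp.single_apply, Pi.single_apply]

theorem shift_e_zero : shift (e 0) = 0 := by
  ext n
  simp [shift_apply, e_apply]

theorem shift_e_succ (n : ℕ) : shift (e (n + 1)) = e n := by
  ext m
  simp [shift_apply, e_apply]

theorem rshift_e (n : ℕ) : rshift (e n) = e (n + 1) := by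
  ext m
  rw [adjoint_shift_apply]
  cases m <;> simp [e_apply]

theorem matUnit_mul_matUnit (i j k l : ℕ) :
    matUnit i j * matUnit k l = if j = k then matUnit i l else 0 := by
  ext1 v
  rw [mul_apply_eq_comp, matUnit_apply, matUnit_apply]
  split_ifs with h
  · simp [e_apply, h, matUnit_apply]
  · simp [e_apply, h]

theorem matUnit_mul_shift (i j : ℕ) : matUnit i j * shift = matUnit i (j + 1) := rfl

theorem matUnit_mul_rshift (i j : ℕ) :
    matUnit i j * rshift = if j = 0 then 0 else matUnit i (j - 1) := by
  ext1 v
  rw [mul_apply_eq_comp, matUnit_apply, adjoint_shift_apply]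
  split_ifs <;> simp [matUnit_apply]

theorem shift_mul_matUnit (i j : ℕ) :
    shift * matUnit i j = if i = 0 then 0 else matUnit (i - 1) j := by
  ext1 v
  rw [mul_apply_eq_comp, matUnit_apply, map_smul]
  cases i <;> simp [shift_e_zero, shift_e_succ, matUnit_apply]

theorem rshift_mul_matUnit (i j : ℕ) : rshift * matUnit i j = matUnit (i + 1) j := by
  ext1 v
  rw [mul_apply_eq_comp, matUnit_apply, map_smul, rshift_e, matUnit_apply]

theorem shift_mul_rshift : shift * rshift = 1 := by
  ext1 v
  ext n
  rw [mul_apply_eq_comp, shift_apply, adjoint_shift_apply]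
  simp

theorem rshift_mul_shift : rshift * shift = 1 - matUnit 0 0 := by
  ext1 v
  ext n
  rw [mul_apply_eq_comp, adjoint_shift_apply, sub_apply, matUnit_apply]
  change _ = v n - v 0 • e 0 n
  cases n <;> simp [shift_apply, e_apply]

theorem matUnit_mem_finMat (i j : ℕ) : matUnit i j ∈ finMat := Submodule.subset_span ⟨(i, j), rfl⟩

/-- The operators that multiply finite matrices into finite matrices from both sides. -/
def finMatIdealizer : Subalgebra ℂ (L2 →L[ℂ] L2) where
  carrier := {R | ∀ T ∈ finMat, R * T ∈ finMat ∧ T * R ∈ finMat}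
  mul_mem' {R R'} h h' T hT :=
    ⟨by rw [mul_assoc]; exact (h _ (h' T hT).1).1, by rw [← mul_assoc]; exact (h' _ (h T hT).2).2⟩
  add_mem' {R R'} h h' T hT :=
    ⟨by rw [add_mul]; exact add_mem (h T hT).1 (h' T hT).1,
      by rw [mul_add]; exact add_mem (h T hT).2 (h' T hT).2⟩
  algebraMap_mem' c T hT := by
    rw [Algebra.algebraMap_eq_smul_one]
    simpa using finMat.smul_mem c hT

theorem mem_finMatIdealizer {R : L2 →L[ℂ] L2}
    (h : ∀ i j, R * matUnit i j ∈ finMat ∧ matUnit i j * R ∈ finMat) : R ∈ finMatIdealizer := by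
  intro T hT
  induction hT using Submodule.span_induction with
  | mem T h' => obtain ⟨p, rfl⟩ := h'; exact h _ _
  | zero => simp
  | add S T _ _ hS hT => rw [mul_add, add_mul]; exact ⟨add_mem hS.1 hT.1, add_mem hS.2 hT.2⟩
  | smul c T _ hT =>
    rw [mul_smul_comm, smul_mul_assoc]
    exact ⟨finMat.smul_mem c hT.1, finMat.smul_mem c hT.2⟩

theorem shift_mem_finMatIdealizer : shift ∈ finMatIdealizer :=
  mem_finMatIdealizer fun i j => by
    rw [shift_mul_matUnit, matUnit_mul_shift]
    refine ⟨?_, matUnit_mem_finMat _ _⟩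
    split_ifs
    exacts [finMat.zero_mem, matUnit_mem_finMat _ _]

theorem rshift_mem_finMatIdealizer : rshift ∈ finMatIdealizer :=
  mem_finMatIdealizer fun i j => by
    rw [rshift_mul_matUnit, matUnit_mul_rshift]
    refine ⟨matUnit_mem_finMat _ _, ?_⟩
    split_ifs
    exacts [finMat.zero_mem, matUnit_mem_finMat _ _]

theorem shiftZ_natCast (n : ℕ) : shiftZ n = shift ^ n := by simp [shiftZ]

theorem shiftZ_neg_natCast (n : ℕ) : shiftZ (-n) = rshift ^ n := by
  rcases n with _ | n
  · simp [shiftZ]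
  · rw [shiftZ, if_neg (by omega)]
    simp

theorem shiftZ_mem_finMatIdealizer (n : ℤ) : shiftZ n ∈ finMatIdealizer := by
  obtain ⟨k, rfl | rfl⟩ := n.eq_nat_or_neg
  · rw [shiftZ_natCast]; exact pow_mem shift_mem_finMatIdealizer k
  · rw [shiftZ_neg_natCast]; exact pow_mem rshift_mem_finMatIdealizer k

theorem shift_mul_shiftZ (n : ℤ) : shift * shiftZ n = shiftZ (n + 1) := by
  obtain ⟨k, rfl | rfl⟩ := n.eq_nat_or_neg
  · rw [shiftZ_natCast, ← pow_succ', ← shiftZ_natCast]; simp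
  · rcases k with _ | k
    · simp [shiftZ]
    · rw [shiftZ_neg_natCast, pow_succ', ← mul_assoc, shift_mul_rshift, one_mul,
        ← shiftZ_neg_natCast]
      congr 1
      push_cast
      ring

theorem rshift_mul_shiftZ_sub_mem (n : ℤ) : rshift * shiftZ n - shiftZ (n - 1) ∈ finMat := by
  obtain ⟨k, rfl | rfl⟩ := n.eq_nat_or_neg
  · rcases k with _ | k
    · have : shiftZ (((0 : ℕ) : ℤ) - 1) = rshift := by
        rw [show (((0 : ℕ) : ℤ) - 1) = -((1 : ℕ) : ℤ) by simp, shiftZ_neg_natCast, pow_one]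
      rw [this, shiftZ_natCast, pow_zero, mul_one, sub_self]
      exact finMat.zero_mem
    · rw [shiftZ_natCast, pow_succ', ← mul_assoc, rshift_mul_shift,
        show ((k + 1 : ℕ) : ℤ) - 1 = (k : ℤ) by simp, shiftZ_natCast, sub_mul, one_mul,
        sub_sub_cancel_left]
      exact neg_mem ((pow_mem shift_mem_finMatIdealizer k) _ (matUnit_mem_finMat 0 0)).2
  · rw [shiftZ_neg_natCast, ← pow_succ', ← shiftZ_neg_natCast,
      show -((k + 1 : ℕ) : ℤ) = -(k : ℤ) - 1 by push_cast; ring, sub_self]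
    exact finMat.zero_mem

/-- Left multiplication by `l` is exact since `l l* = 1`. Left multiplication by `l*` costs at most
a finite matrix, coming from `l* l = 1 - e₀₀`, and these errors stay finite under further shifts. -/
theorem shiftZ_mul_sub_mem (m n : ℤ) : shiftZ m * shiftZ n - shiftZ (m + n) ∈ finMat := by
  obtain ⟨k, rfl | rfl⟩ := m.eq_nat_or_neg
  · suffices h : shiftZ k * shiftZ n = shiftZ (k + n) by
      rw [h, sub_self]; exact finMat.zero_mem
    induction k with
    | zero => rw [shiftZ_natCast, pow_zero, one_mul, Nat.cast_zero, zero_add]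
    | succ k ih =>
      rw [shiftZ_natCast] at ih ⊢
      rw [pow_succ', mul_assoc, ih, shift_mul_shiftZ]
      congr 1
      push_cast
      ring
  · induction k with
    | zero =>
      have : shiftZ (-((0 : ℕ) : ℤ)) = 1 := by rw [shiftZ_neg_natCast, pow_zero]
      rw [this]
      simp
    | succ k ih =>
      rw [shiftZ_neg_natCast] at ih ⊢
      convert add_mem (rshift_mem_finMatIdealizer _ ih).1
        (rshift_mul_shiftZ_sub_mem (-(k : ℤ) + n)) using 1
      rw [pow_succ', mul_sub, ← mul_assoc, sub_add_sub_cancel]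
      congr 2
      push_cast
      ring

/-- The linear map `f ↦ σ'(f)`. -/
def sigmaLin : ℂ[T;T⁻¹] →ₗ[ℂ] (L2 →L[ℂ] L2) where
  toFun := sigma'
  map_add' f g := Finsupp.sum_add_index' (by simp) (by simp [add_smul])
  map_smul' c f := by
    rw [sigma', AddMonoidAlgebra.coeff_smul, Finsupp.sum_smul_index' (by simp)]
    simp [sigma', Finsupp.smul_sum, smul_smul]

theorem sigmaLin_apply (f : ℂ[T;T⁻¹]) : sigmaLin f = sigma' f := rfl

theorem sigmaLin_T (n : ℤ) : sigmaLin (T n) = shiftZ n := by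
  have : (T n : ℂ[T;T⁻¹]).coeff = Finsupp.single n 1 := rfl
  rw [sigmaLin_apply, sigma', this, Finsupp.sum_single_index] <;> simp

theorem sigmaLin_mul_sub_mem (f g : ℂ[T;T⁻¹]) :
    sigmaLin f * sigmaLin g - sigmaLin (f * g) ∈ finMat := by
  induction f using LaurentPolynomial.induction_on' with
  | add f f' h h' =>
    convert add_mem h h' using 1
    rw [add_mul, map_add, map_add, add_mul]
    abel
  | C_mul_T m c =>
    induction g using LaurentPolynomial.induction_on' with
    | add g g' h h' =>
      convert add_mem h h' using 1
      rw [mul_add, map_add, map_add, mul_add]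
      abel
    | C_mul_T n d =>
      convert finMat.smul_mem (c * d) (shiftZ_mul_sub_mem m n) using 1
      rw [← smul_eq_C_mul, ← smul_eq_C_mul, smul_mul_smul_comm, ← T_add]
      simp only [map_smul, sigmaLin_T, smul_mul_smul_comm, smul_sub]

theorem shiftZ_e (n : ℤ) (i j : ℕ) : shiftZ n (e j) i = if (j : ℤ) - i = n then 1 else 0 := by
  obtain ⟨k, rfl | rfl⟩ := n.eq_nat_or_neg
  · rw [shiftZ_natCast]
    induction k generalizing i with
    | zero =>
      rw [pow_zero, one_apply_eq_self, e_apply]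
      exact if_congr (by omega) rfl rfl
    | succ k ih =>
      rw [pow_succ', mul_apply_eq_comp, shift_apply, ih]
      exact if_congr (by omega) rfl rfl
  · rw [shiftZ_neg_natCast]
    induction k generalizing i with
    | zero =>
      rw [pow_zero, one_apply_eq_self, e_apply]
      exact if_congr (by omega) rfl rfl
    | succ k ih =>
      rw [pow_succ', mul_apply_eq_comp, adjoint_shift_apply]
      rcases i with _ | i
      · rw [if_pos rfl, if_neg (by omega)]
      · rw [if_neg (by omega), Nat.add_sub_cancel, ih]
        exact if_congr (by omega) rfl rfl

theorem sigmaLin_e (f : ℂ[T;T⁻¹]) (i j : ℕ) : sigmaLin f (e j) i = f.coeff (j - i) := by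
  induction f using LaurentPolynomial.induction_on' with
  | add f g hf hg =>
    rw [map_add, add_apply, lp.coeFn_add, Pi.add_apply, hf, hg, AddMonoidAlgebra.coeff_add,
      Finsupp.add_apply]
  | C_mul_T n c =>
    rw [← smul_eq_C_mul, map_smul, sigmaLin_T, smul_apply, lp.coeFn_smul, Pi.smul_apply, shiftZ_e,
      AddMonoidAlgebra.coeff_smul_apply, T_apply]
    simp only [eq_comm]

/-- The projection onto the span of the first `m` basis vectors. -/
def finProj (m : ℕ) : L2 →L[ℂ] L2 := ∑ i ∈ Finset.range m, matUnit i i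

theorem eventually_finProj_mul {S : L2 →L[ℂ] L2} (hS : S ∈ finMat) :
    ∀ᶠ m in atTop, finProj m * S = S ∧ S * finProj m = S := by
  induction hS using Submodule.span_induction with
  | mem S h =>
    obtain ⟨⟨i, j⟩, rfl⟩ := h
    filter_upwards [eventually_gt_atTop i, eventually_gt_atTop j] with m hi hj
    simp [finProj, Finset.sum_mul, Finset.mul_sum, matUnit_mul_matUnit, hi, hj]
  | zero => simp
  | add S T _ _ hS hT =>
    filter_upwards [hS, hT] with m hS hT
    simp [mul_add, add_mul, hS, hT]
  | smul c S _ hS =>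
    filter_upwards [hS] with m hS
    simp [hS]

end Shift

/-! ### The quantum double suspension as an extension -/

section Algebra

variable (A : Type*) [Ring A] [Algebra ℂ A]

variable {A} in
theorem tens_mem_tensorFinSpan (a : A) {T : L2 →L[ℂ] L2} (hT : T ∈ finMat) :
    tens A a T ∈ tensorFinSpan A :=
  Submodule.subset_span ⟨a, T, hT, rfl⟩

variable {A} in
theorem tens_one_mul_mem {R : L2 →L[ℂ] L2} (hR : R ∈ finMatIdealizer) {x : TensorB A}
    (hx : x ∈ tensorFinSpan A) :
    tens A 1 R * x ∈ tensorFinSpan A ∧ x * tens A 1 R ∈ tensorFinSpan A := by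
  induction hx using Submodule.span_induction with
  | mem x h =>
    obtain ⟨a, T, hT, rfl⟩ := h
    rw [tens_mul, tens_mul]
    exact ⟨tens_mem_tensorFinSpan _ (hR T hT).1, tens_mem_tensorFinSpan _ (hR T hT).2⟩
  | zero => simp
  | add x y _ _ hx hy =>
    rw [mul_add, add_mul]
    exact ⟨add_mem hx.1 hy.1, add_mem hx.2 hy.2⟩
  | smul c x _ hx =>
    rw [mul_smul_comm, smul_mul_assoc]
    exact ⟨Submodule.smul_mem _ c hx.1, Submodule.smul_mem _ c hx.2⟩

theorem sigma'_mem_finMatIdealizer (f : ℂ[T;T⁻¹]) : sigma' f ∈ finMatIdealizer :=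
  sum_mem fun n _ => Subalgebra.smul_mem _ (shiftZ_mem_finMatIdealizer n) _

variable {A} in
theorem susp_mul_mem {b : TensorB A} (hb : b ∈ susp A) :
    ∀ x ∈ tensorFinSpan A, b * x ∈ tensorFinSpan A ∧ x * b ∈ tensorFinSpan A := by
  induction hb using Algebra.adjoin_induction with
  | mem b h =>
    intro x hx
    obtain ⟨a, T, hT, rfl⟩ | ⟨f, rfl⟩ := h
    · exact ⟨tensorFinSpan_mul (tens_mem_tensorFinSpan a hT) hx,
        tensorFinSpan_mul hx (tens_mem_tensorFinSpan a hT)⟩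
    · exact tens_one_mul_mem (sigma'_mem_finMatIdealizer f) hx
  | algebraMap c =>
    intro x hx
    rw [Algebra.algebraMap_eq_smul_one]
    simpa using Submodule.smul_mem _ c hx
  | add b b' _ _ h h' =>
    intro x hx
    rw [add_mul, mul_add]
    exact ⟨add_mem (h x hx).1 (h' x hx).1, add_mem (h x hx).2 (h' x hx).2⟩
  | mul b b' _ _ h h' =>
    intro x hx
    rw [mul_assoc, ← mul_assoc x]
    exact ⟨(h _ (h' x hx).1).1, (h' _ (h x hx).2).2⟩

/-- The linear map `f ↦ 1 ⊗ σ'(f)` into `Σ²A`. -/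
def suspSymbol : ℂ[T;T⁻¹] →ₗ[ℂ] susp A :=
  ((tens A 1).comp sigmaLin).codRestrict (Subalgebra.toSubmodule (susp A)) fun f =>
    Algebra.subset_adjoin (Or.inr ⟨f, rfl⟩)

theorem coe_suspSymbol (f : ℂ[T;T⁻¹]) : (suspSymbol A f : TensorB A) = tens A 1 (sigmaLin f) := rfl

theorem suspSymbol_mul_sub_mem (f g : ℂ[T;T⁻¹]) :
    suspSymbol A f * suspSymbol A g - suspSymbol A (f * g) ∈ tensorFin A := by
  change tens A 1 (sigmaLin f) * tens A 1 (sigmaLin g) - tens A 1 (sigmaLin (f * g)) ∈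
    tensorFinSpan A
  rw [tens_mul, mul_one, ← map_sub]
  exact tens_mem_tensorFinSpan _ (sigmaLin_mul_sub_mem f g)

theorem suspSymbol_one : suspSymbol A 1 = 1 := by
  refine Subtype.ext ?_
  rw [coe_suspSymbol, ← T_zero, sigmaLin_T]
  simp [shiftZ, tens_one]

variable {A} in
theorem mul_mem_tensorFin_left (b : susp A) {s : susp A} (hs : s ∈ tensorFin A) : b * s ∈ tensorFin A :=
  (susp_mul_mem b.2 _ hs).1

variable {A} in
theorem mul_mem_tensorFin_right (b : susp A) {s : susp A} (hs : s ∈ tensorFin A) :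
    s * b ∈ tensorFin A :=
  (susp_mul_mem b.2 _ hs).2

variable {A} in
theorem exists_suspSymbol (b : susp A) : ∃ f, b - suspSymbol A f ∈ tensorFin A := by
  obtain ⟨b, hb⟩ := b
  induction hb using Algebra.adjoin_induction with
  | mem b h =>
    obtain ⟨a, T, hT, rfl⟩ | ⟨f, rfl⟩ := h
    · refine ⟨0, ?_⟩
      rw [map_zero, sub_zero]
      exact tens_mem_tensorFinSpan a hT
    · refine ⟨f, ?_⟩
      have : (⟨_, Algebra.subset_adjoin (Or.inr ⟨f, rfl⟩)⟩ : susp A) = suspSymbol A f := rfl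
      rw [this, sub_self]
      exact (tensorFin A).zero_mem
  | algebraMap c =>
    refine ⟨c • 1, ?_⟩
    have : (⟨algebraMap ℂ (TensorB A) c, (susp A).algebraMap_mem c⟩ : susp A)
        = c • suspSymbol A 1 := by
      rw [suspSymbol_one, ← Algebra.algebraMap_eq_smul_one]
      rfl
    rw [this, map_smul, sub_self]
    exact (tensorFin A).zero_mem
  | add b b' hb hb' h h' =>
    obtain ⟨f, hf⟩ := h
    obtain ⟨f', hf'⟩ := h'
    refine ⟨f + f', ?_⟩
    convert add_mem hf hf' using 1
    rw [map_add, sub_add_sub_comm]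
    rfl
  | mul b b' hb hb' h h' =>
    obtain ⟨f, hf⟩ := h
    obtain ⟨f', hf'⟩ := h'
    refine ⟨f * f', ?_⟩
    -- Telescoping: `b b' - σ(f f')` is `(b - σ(f)) b' + σ(f)(b' - σ(f'))` plus the defect of
    -- multiplicativity of `σ`.
    convert add_mem (add_mem (mul_mem_tensorFin_right ⟨b', hb'⟩ hf)
      (mul_mem_tensorFin_left (suspSymbol A f) hf')) (suspSymbol_mul_sub_mem A f f') using 1
    rw [sub_mul, mul_sub, sub_add_sub_cancel, sub_add_sub_cancel]
    rfl

/-- The element `a ⊗ eᵢⱼ` of `Σ²A`. -/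
def suspUnit (a : A) (i j : ℕ) : susp A :=
  ⟨tens A a (matUnit i j), Algebra.subset_adjoin (Or.inl ⟨a, _, matUnit_mem_finMat i j, rfl⟩)⟩

variable {A} in
theorem suspUnit_mem (a : A) (i j : ℕ) : suspUnit A a i j ∈ tensorFin A :=
  tens_mem_tensorFinSpan a (matUnit_mem_finMat i j)

/-- The element `1 ⊗ Pₘ` of `Σ²A`, with `Pₘ` the projection onto the first `m` basis vectors. -/
def suspProj (m : ℕ) : susp A := ∑ i ∈ Finset.range m, suspUnit A 1 i i

theorem coe_suspProj (m : ℕ) : (suspProj A m : TensorB A) = tens A 1 (finProj m) := by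
  rw [suspProj, finProj, map_sum, AddSubmonoidClass.coe_finsetSum]
  rfl

variable {A} in
theorem eventually_suspProj_mul {s : susp A} (hs : s ∈ tensorFin A) :
    ∀ᶠ m in atTop, suspProj A m * s = s ∧ s * suspProj A m = s := by
  suffices h : ∀ x ∈ tensorFinSpan A,
      ∀ᶠ m in atTop, tens A 1 (finProj m) * x = x ∧ x * tens A 1 (finProj m) = x by
    filter_upwards [h s hs] with m hm
    rw [← coe_suspProj] at hm
    exact ⟨Subtype.ext hm.1, Subtype.ext hm.2⟩
  intro x hx
  induction hx using Submodule.span_induction with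
  | mem x h =>
    obtain ⟨a, S, hS, rfl⟩ := h
    filter_upwards [eventually_finProj_mul hS] with m hm
    rw [tens_mul, tens_mul, hm.1, hm.2, one_mul, mul_one]
    exact ⟨rfl, rfl⟩
  | zero => simp
  | add x y _ _ hx hy =>
    filter_upwards [hx, hy] with m hx hy
    simp [mul_add, add_mul, hx, hy]
  | smul c x _ hx =>
    filter_upwards [hx] with m hx
    simp [hx]

end Algebra

/-! ### Operators on `H ⊗ ℓ²(ℕ)` -/

section Operators

variable {H : Type*} [NormedAddCommGroup H] [InnerProductSpace ℂ H]

theorem opTensor_eq (S : H →L[ℂ] H) (T : L2 →L[ℂ] L2) :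
    opTensor S T = ampLeft S * ampRight T := by
  change _ = opTensor S 1 * opTensor 1 T
  rw [opTensor_mul, mul_one, one_mul]

theorem opTensor_smul_left (c : ℂ) (S : H →L[ℂ] H) (T : L2 →L[ℂ] L2) :
    opTensor (c • S) T = c • opTensor S T := by
  rw [opTensor_eq, opTensor_eq, map_smul, smul_mul_assoc]

theorem opTensor_one_pow (S : H →L[ℂ] H) (n : ℕ) :
    opTensor S (1 : L2 →L[ℂ] L2) ^ n = opTensor (S ^ n) 1 :=
  (map_pow ampLeft S n).symm

theorem norm_incl (n : ℕ) (h : H) : ‖incl n h‖ = ‖h‖ := by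
  rw [incl_apply, UniformSpace.Completion.norm_coe, TensorProduct.norm_tmul, e,
    lp.norm_single (by simp), norm_one, mul_one]

variable [CompleteSpace H]

theorem isCommutator_shiftZ (D : H →ₗ.[ℂ] H) (F : H →L[ℂ] H) (n : ℤ) :
    IsCommutator (suspOp D F) (opTensor 1 (shiftZ n)) (-(n : ℂ) • opTensor F (shiftZ n)) := by
  -- Used with `c = -1` for `l` and `c = 1` for `l*`; by the Leibniz rule the weights add up under
  -- powers.
  have key : ∀ (c : ℂ) (R : L2 →L[ℂ] L2),
      IsCommutator (suspOp D F) (opTensor 1 R) (c • opTensor F R) → ∀ k : ℕ,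
      IsCommutator (suspOp D F) (opTensor 1 (R ^ k)) ((k * c) • opTensor F (R ^ k)) := by
    intro c R h k
    induction k with
    | zero =>
      rw [Nat.cast_zero, zero_mul, zero_smul, pow_zero,
        show opTensor (1 : H →L[ℂ] H) 1 = 1 from map_one ampLeft]
      exact IsCommutator.one _
    | succ k ih =>
      convert h.mul ih using 1
      · rw [opTensor_mul, one_mul, pow_succ']
      · rw [smul_mul_assoc, mul_smul_comm, opTensor_mul, opTensor_mul, one_mul, mul_one,
          ← pow_succ', ← add_smul]
        congr 1
        push_cast
        ring
  obtain ⟨k, rfl | rfl⟩ := n.eq_nat_or_neg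
  · rw [shiftZ_natCast]
    convert key (-1) shift ?_ k using 2
    · simp
    · rw [← opTensor_smul_left, neg_one_smul]
      exact isCommutator_shift D F
  · rw [shiftZ_neg_natCast]
    convert key 1 _ ?_ k using 2
    · simp
    · rw [one_smul]
      exact isCommutator_adjoint_shift D F

theorem norm_slice_le (n : ℕ) (x : HL2 H) : ‖slice n x‖ ≤ ‖x‖ := by
  have h1 : ‖(slice n : HL2 H →L[ℂ] H)‖ ≤ 1 := by
    rw [slice, LinearIsometryEquiv.norm_map]
    exact ContinuousLinearMap.opNorm_le_bound _ zero_le_one fun h => by rw [norm_incl, one_mul]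
  simpa using (slice n).le_of_opNorm_le h1 x

theorem slice_opTensor_incl (S : H →L[ℂ] H) (T : L2 →L[ℂ] L2) (i j : ℕ) (h : H) :
    slice i (opTensor S T (incl j h)) = T (e j) i • S h := by
  rw [incl_apply, opTensor_coe, slice_coe]

/-- A Toeplitz operator that agrees with a compact operator far out has vanishing symbol. -/
theorem eq_zero_of_isCompactOperator {S : H →L[ℂ] H} {h : H} (hS : S h ≠ 0) {f : ℂ[T;T⁻¹]}
    {K : HL2 H →L[ℂ] HL2 H} (hK : IsCompactOperator K)
    (hKf : ∀ᶠ j in atTop, K (incl j h) = opTensor S (sigmaLin f) (incl j h)) : f = 0 := by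
  by_contra hf
  obtain ⟨k, hk⟩ : ∃ k, f.coeff k ≠ 0 := by
    by_contra! h0
    exact hf (LaurentPolynomial.ext h0)
  have hslice : ∀ i, ∀ᶠ j in atTop, slice i (K (incl j h)) = f.coeff (j - i) • S h := by
    intro i
    filter_upwards [hKf] with j hj
    rw [hj, slice_opTensor_incl, sigmaLin_e]
  -- The vectors `h ⊗ eⱼ` all have norm `‖h‖`, so their images under `K` have a convergent
  -- subsequence. Each fixed row of the limit vanishes, because row `i` of column `j` is eventually
  -- `f_{j-i} S h`, which is zero for large `j`.
  obtain ⟨Z, hZ, hKZ⟩ := hK.image_closedBall_subset_compact (𝕜₁ := ℂ) (f := K.toLinearMap) ‖h‖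
  obtain ⟨y, -, φ, hφ, hy⟩ := hZ.tendsto_subseq (x := fun j => K (incl j h)) fun j =>
    hKZ ⟨incl j h, by simp [norm_incl], rfl⟩
  have hy0 : y = 0 := by
    refine slice_ext fun i => ?_
    rw [map_zero]
    have h1 : Tendsto (fun j => slice i (K (incl (φ j) h))) atTop (nhds (slice i y)) :=
      ((slice i).continuous.tendsto y).comp hy
    refine tendsto_nhds_unique h1 (tendsto_const_nhds.congr' ?_)
    have h2 : ∀ᶠ j : ℕ in atTop, f.coeff ((j : ℤ) - i) = 0 := by
      obtain ⟨M, hM⟩ := f.coeff.support.bddAbove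
      filter_upwards [eventually_gt_atTop (M + i).toNat] with j hj
      by_contra h0
      have := hM (Finsupp.mem_support_iff.2 h0)
      omega
    filter_upwards [hφ.tendsto_atTop.eventually (hslice i), hφ.tendsto_atTop.eventually h2]
      with j hj hj'
    rw [hj, hj', zero_smul]
  -- The moving row `j - k` always carries `f_k S h`, which keeps the norms away from zero and
  -- contradicts the zero limit.
  have h3 : ∀ᶠ j in atTop, ‖f.coeff k • S h‖ ≤ ‖K (incl j h)‖ := by
    filter_upwards [hKf, eventually_ge_atTop k.toNat] with j hj hjk
    refine le_trans (le_of_eq ?_) (norm_slice_le (j - k).toNat _)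
    rw [hj, slice_opTensor_incl, sigmaLin_e]
    congr 3
    omega
  have h4 : Tendsto (fun j => ‖K (incl (φ j) h)‖) atTop (nhds 0) := by
    simpa [hy0] using hy.norm
  have h5 := ge_of_tendsto h4 (hφ.tendsto_atTop.eventually h3)
  exact (norm_pos_iff.2 (smul_ne_zero hk hS)).not_ge h5

theorem signOp_mul_signOp (D : H →ₗ.[ℂ] H) : signOp D * signOp D = 1 := by
  have key : ∀ P : H →L[ℂ] H, IsIdempotentElem P →
      ((2 : ℂ) • P - 1) * ((2 : ℂ) • P - 1) = 1 := fun P hP => by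
    have hP' : P * P = P := hP
    simp only [sub_mul, mul_sub, smul_mul_assoc, mul_smul_comm, hP', one_mul, mul_one]
    module
  exact key _ (Submodule.isIdempotentElem_starProjection _)

end Operators

/-! ### Commutators on the suspension and the axioms of a Laurent extension -/

namespace SpectralTriple

variable {A H : Type*} [Ring A] [Algebra ℂ A] [StarRing A] [StarModule ℂ A]
  [NormedAddCommGroup H] [InnerProductSpace ℂ H] [CompleteSpace H] (X : SpectralTriple A H)

theorem qds_rep (b : susp A) : X.qds.rep b = X.tensorRep b := rfl

theorem qds_rep_suspSymbol (f : ℂ[T;T⁻¹]) :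
    X.qds.rep (suspSymbol A f) = opTensor 1 (sigmaLin f) := by
  rw [qds_rep, coe_suspSymbol, tensorRep_tens, map_one]

theorem qds_rep_suspUnit (i j : ℕ) :
    X.qds.rep (suspUnit A 1 i j) = opTensor 1 (matUnit i j) := by
  rw [qds_rep, suspUnit, tensorRep_tens, map_one]

theorem qds_rep_suspProj (m : ℕ) : X.qds.rep (suspProj A m) = opTensor 1 (finProj m) := by
  rw [qds_rep, coe_suspProj, tensorRep_tens, map_one]

theorem qds_comm_suspUnit (i j : ℕ) :
    X.qds.comm (suspUnit A 1 i j) = ((i : ℂ) - j) • opTensor (signOp X.D) (matUnit i j) := by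
  refine X.qds.comm_eq ?_
  rw [qds_rep_suspUnit]
  have h := isCommutator_matUnit (signOp X.D) (IsCommutator.one X.D) i j
  rwa [zero_add, mul_one, one_mul, ← sub_smul, opTensor_smul_left] at h

theorem qds_comm_suspSymbol (f : ℂ[T;T⁻¹]) :
    X.qds.comm (suspSymbol A f)
      = opTensor (signOp X.D) 1 * X.qds.rep (suspSymbol A (eulerDeriv f)) := by
  induction f using LaurentPolynomial.induction_on' with
  | add f g hf hg => rw [map_add, DiracData.comm_add, hf, hg, ← mul_add]; simp only [map_add]
  | C_mul_T n c =>
    rw [← smul_eq_C_mul, map_smul, DiracData.comm_smul, map_smul, map_smul, map_smul,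
      mul_smul_comm, eulerDeriv_T, map_smul, map_smul, qds_rep_suspSymbol, mul_smul_comm,
      opTensor_mul, mul_one, one_mul, sigmaLin_T]
    congr 1
    refine X.qds.comm_eq ?_
    rw [qds_rep_suspSymbol, sigmaLin_T]
    exact isCommutator_shiftZ _ _ _

/-- `1 ⊗ Pₘ` commutes with the Dirac operator because `Pₘ` is diagonal: `[D, 1 ⊗ eᵢⱼ]` has the
factor `i - j`. -/
theorem isLocallyUnital_qds : X.qds.IsLocallyUnital (tensorFin A) (suspProj A) where
  mul_mem_left b _ hs := mul_mem_tensorFin_left b hs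
  mul_mem_right b _ hs := mul_mem_tensorFin_right b hs
  mem _ := sum_mem fun i _ => suspUnit_mem 1 i i
  comm_eq_zero m := by
    change X.qds.commLin _ = 0
    rw [suspProj, map_sum]
    refine Finset.sum_eq_zero fun i _ => ?_
    change X.qds.comm _ = 0
    rw [qds_comm_suspUnit, sub_self, zero_smul]
  unit_mul _ hs := (eventually_suspProj_mul hs).mono fun _ h => h.1
  mul_unit _ hs := (eventually_suspProj_mul hs).mono fun _ h => h.2

theorem isLaurentExtension_qds :
    X.qds.IsLaurentExtension (tensorFin A) (suspProj A) (suspSymbol A)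
      (opTensor (signOp X.D) 1) where
  toIsLocallyUnital := X.isLocallyUnital_qds
  one_eq := suspSymbol_one A
  mul_sub_mem := suspSymbol_mul_sub_mem A
  exists_symbol := exists_suspSymbol
  comm_symbol := X.qds_comm_suspSymbol
  commute f := by
    rw [qds_rep_suspSymbol, Commute, SemiconjBy, opTensor_mul, opTensor_mul]
    simp only [mul_one, one_mul]
  mul_unit_mem m := by
    rw [suspProj, map_sum, Finset.mul_sum]
    refine sum_mem fun i _ => ?_
    -- `F ⊗ eᵢᵢ` is `(1 ⊗ e_{i,i+1}) [D, 1 ⊗ e_{i+1,i}]`: an off-diagonal unit is needed, and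
    -- stepping by one makes the factor equal to `1`.
    convert X.qds.mul_comm_mem_nuOp_succ
      (X.qds.rep_mem_nuOp (suspUnit_mem (1 : A) i (i + 1))) (suspUnit_mem (1 : A) (i + 1) i) using 1
    rw [qds_comm_suspUnit, qds_rep_suspUnit, qds_rep_suspUnit, mul_smul_comm, opTensor_mul,
      opTensor_mul, matUnit_mul_matUnit, if_pos rfl]
    simp

/-- As `y = y pₘ` for some `m`, `y` kills `h ⊗ eⱼ` for `j ≥ m`. There the compact operator agrees
with `F^n ⊗ σ'(f)`, and `F^n h ≠ 0` because `F² = 1`. -/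
theorem symbolInjective_qds [Nontrivial H] :
    DiracData.SymbolInjective X.qds (tensorFin A) (suspSymbol A) (opTensor (signOp X.D) 1) := by
  intro n f y hy hK
  obtain ⟨h, hh⟩ := exists_ne (0 : H)
  have hS : (signOp X.D ^ n) h ≠ 0 := by
    intro h0
    have h1 : signOp X.D ^ n * signOp X.D ^ n = 1 := by
      rw [← (Commute.refl _).mul_pow, signOp_mul_signOp, one_pow]
    have h2 := congrArg (fun R => R h) h1
    simp only [mul_apply_eq_comp, h0, map_zero, one_apply_eq_self] at h2
    exact hh h2.symm
  obtain ⟨m, hm⟩ := (X.isLocallyUnital_qds.eventually_mul_unit hy).exists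
  refine eq_zero_of_isCompactOperator hS hK ?_
  filter_upwards [eventually_ge_atTop m] with j hj
  have h1 : y (incl j h) = 0 := by
    rw [← hm, mul_apply_eq_comp, qds_rep_suspProj, incl_apply, opTensor_coe]
    have h2 : finProj m (e j) = 0 := by
      rw [finProj, sum_apply]
      refine Finset.sum_eq_zero fun i hi => ?_
      rw [matUnit_apply, e_apply, if_neg (by have := Finset.mem_range.1 hi; omega), zero_smul]
    rw [h2, TensorProduct.tmul_zero, UniformSpace.Completion.coe_zero, map_zero]
  rw [sub_apply, h1, sub_zero, opTensor_one_pow, qds_rep_suspSymbol, opTensor_mul, mul_one, one_mul]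

theorem nontrivial_susp [Nontrivial H] (X : SpectralTriple A H) : Nontrivial (susp A) := by
  obtain ⟨h, hh⟩ := exists_ne (0 : H)
  refine ⟨⟨1, 0, fun h1 => hh ?_⟩⟩
  have h2 := congrArg (fun b => X.qds.rep b (incl 0 h)) h1
  simp only [map_one, map_zero, one_apply_eq_self, zero_apply] at h2
  rw [← norm_eq_zero, ← norm_incl 0 h, h2, norm_zero]

end SpectralTriple

end QDS

end

/-! ### The calculus of the quantum double suspension -/

theorem mainTheorem5 {A H : Type*} [Ring A] [Algebra ℂ A] [StarRing A] [StarModule ℂ A]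
    [NormedAddCommGroup H] [InnerProductSpace ℂ H] [CompleteSpace H] [Nontrivial H]
    (X : QDS.SpectralTriple A H) :
    (∃ Φ : X.qds.Omega 1 ≃ₗ[ℂ] X.qds.NuOmega (QDS.tensorFin A) 1 × ℂ[T;T⁻¹],
      (∀ (s₀ : QDS.tensorFin A) (s : Fin 1 → QDS.tensorFin A),
        Φ (X.qds.omegaMk (s₀ : QDS.susp A) (fun i => (s i : QDS.susp A))) =
          (X.qds.nuOmegaMk (QDS.tensorFin A) s₀ s, 0)) ∧
      ∀ f : ℂ[T;T⁻¹], ∃ ω : QDS.UForm (QDS.susp A) 1,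
        X.qds.pi 1 ω = QDS.toCalkin (QDS.HL2 H)
          (QDS.opTensor (QDS.signOp X.D) (QDS.sigma' f)) ∧
        Φ ((X.qds.J 1).mkQ ω) = (0, f)) ∧
    ∀ n : ℕ, 2 ≤ n →
      ∃ Φ : X.qds.Omega n ≃ₗ[ℂ] X.qds.NuOmega (QDS.tensorFin A) n,
        ∀ (s₀ : QDS.tensorFin A) (s : Fin n → QDS.tensorFin A),
          Φ (X.qds.omegaMk (s₀ : QDS.susp A) (fun i => (s i : QDS.susp A))) =
            X.qds.nuOmegaMk (QDS.tensorFin A) s₀ s := by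
  have hX := X.isLaurentExtension_qds
  have := X.nontrivial_susp
  refine ⟨?_, fun n hn => hX.exists_omega_equiv hn⟩
  obtain ⟨Φ, h1, h2⟩ := hX.exists_omega_one_equiv X.symbolInjective_qds
  refine ⟨Φ, fun s₀ s => ?_, fun f => ?_⟩
  · rw [← QDS.DiracData.nuOmegaMap_nuOmegaMk, h1]
  · obtain ⟨ω, hω, hΦ⟩ := h2 f
    refine ⟨ω, ?_, hΦ⟩
    rw [QDS.DiracData.pi, LinearMap.comp_apply, hω, X.qds_rep_suspSymbol, QDS.opTensor_mul,
      mul_one, one_mul, QDS.sigmaLin_apply]
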